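/- Consider the two-sorted relational language with sorts $O$ and $D$ and relation symbols $E\subseteq O^2$, $P\subseteq O$, $R\subseteq O^2\times D$. Let $\mathcal K$ be the class of finite structures in which $E$ is an equivalence relation on $O$, $R(x,y,w)$ implies $E(x,y)$, and $R(x,y,w)$ implies $\neg R(y,x,w)$. Then $\mathcal K$ is a Fraïssé class and has a (countable) Fraïssé limit. Let $T$ be the complete theory of this limit. The following hold. (a) In every model of $T$ the axioms above hold and $E$ has infinitely many classes, on each of which $P$ is infinite and coinfinite. Moreover: for every $E$-class $C$, all finite $F\subseteq C$, $W\subseteq D$, and every assignment to each $(y,d)\in F\times W$ of one of the options "$R(x,y,d)$", "$R(y,x,d)$", "neither", there is $x\in C\setminus F$, inside $P$ or outside $P$ as we like, satisfying exactly the assigned relations; and for every finite $F\subseteq O$ and every irreflexive antisymmetric relation $S$ on $F$ contained in $E$, infinitely many $d\in D$ satisfy $R(y,z,d)\leftrightarrow S(y,z)$ for all $y,z\in F$. (b) Let $\kappa$ be an infinite cardinal and $\mathfrak U\models T$ be $\kappa$-saturated and $\kappa$-strongly homogeneous; "small" means of cardinality $<\kappa$. Let $x,y$ be single variables of sort $O$,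 and let $\pi(x)=\{\neg E(x,d)\mid d\in O(\mathfrak U)\}$. Then $\pi(x)\cup\{P(x)\}$ and $\pi(y)\cup\{\neg P(y)\}$ axiomatise complete types $p(x)$ and $q(y)$ over $\mathfrak U$, and $p,q$ are $\emptyset$-invariant. For $A\subseteq\mathfrak U$, let $S_{pq}(A)$ be the set of complete types $r(x,y)$ over $A$ containing $(p\upharpoonright A)(x)\cup (q\upharpoonright A)(y)$. A global type $p$ dominates $q$ if $p(x)\cup r(x,y)\vdash q(y)$ for some small $A$ and some $r\in S_{pq}(A)$. * There is $r\in S_{pq}(\emptyset)$ containing $\rho(x,y):=E(x,y)\wedge P(x)\wedge\neg P(y)$, and for every such $r$ both $p(x)\cup r(x,y)\vdash q(y)$ and $q(y)\cup r(x,y)\vdash p(x)$. In particular $p$ dominates $q$ and $q$ dominates $p$. * For every small $A\subseteq\mathfrak U$ and every $r\in S_{pq}(A)$ containing $E(x,y)$, there is $d\in D(\mathfrak U)$ such that $p\cup r$ implies neither $R(x,y,d)$ nor $\neg R(x,y,d)$, and likewise for $q\cup r$. * For all realisations $a\models p$ and $b\models q$ in an elementary extension of $\mathfrak U$, neither $\operatorname{tp}(a/\mathfrak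 U b)$ nor $\operatorname{tp}(b/\mathfrak U a)$ is $\mathrm F^{\mathrm s}_\kappa$-isolated. Here a complete type $t$ over a set $B$ is $\mathrm F^{\mathrm s}_\kappa$-isolated if there is $A\subseteq B$ with $|A|<\kappa$ and $t\upharpoonright A\vdash t$. -/

import Mathlib

open FirstOrder FirstOrder.Language Cardinal

namespace FirstOrder.Domination

universe u v w w'

section General

variable {L : Language.{u, v}}

/-- The set of formulas `φ(x)` belonging to a complete type. -/
def formulas {T : L.Theory} {α : Type w} (p : T.CompleteType α) : Set (L.Formula α) :=
  {φ | Formula.equivSentence φ ∈ p}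

/-- `Γ(x) ⊢ φ(x)` modulo `T`: in every model of `T`, every realisation of the partial type `Γ`
satisfies `φ`. As in Mathlib's `⊨ᵇ`, the models range over the universe `max u v w`, which is large
enough by compactness and Löwenheim-Skolem. -/
def Entails (T : L.Theory) {α : Type w} (Γ : Set (L.Formula α)) (φ : L.Formula α) : Prop :=
  ∀ (M : Theory.ModelType.{u, v, max u v w} T) (x : α → M), (∀ ψ ∈ Γ, ψ.Realize x) → φ.Realize x

variable (L) in
/-- `S_α(A)`: complete types over the parameter set `A ⊆ M`, in variables indexed by `α`. -/
abbrev TypeOver {M : Type w} [L.Structure M] (A : Set M) (α : Type w') :=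
  (L[[A]].completeTheory M).CompleteType α

variable (L) in
/-- `S_α(M)`: complete types over the whole structure `M`. -/
abbrev GlobalType (M : Type w) [L.Structure M] (α : Type w') :=
  (L.elementaryDiagram M).CompleteType α

/-- Formulas over `A` as formulas over a larger parameter set `B`. -/
abbrev inclSet {M : Type w} {A B : Set M} (h : A ⊆ B) {α : Type w'} (φ : L[[A]].Formula α) :
    L[[B]].Formula α :=
  (L.lhomWithConstantsMap (Set.inclusion h)).onFormula φ

/-- Formulas over `A` as formulas over all of `M`. -/
abbrev inclTop {M : Type w} {A : Set M} {α : Type w'} (φ : L[[A]].Formula α) : L[[M]].Formula α :=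
  (L.lhomWithConstantsMap ((↑) : A → M)).onFormula φ

/-- The formula `φ(x; b)` with parameters `b`, obtained from `φ(x; y)`. -/
def instantiate {M : Type w} {α : Type w'} {n : ℕ} (φ : L.Formula (α ⊕ Fin n)) (b : Fin n → M) :
    L[[M]].Formula α :=
  ((L.lhomWithConstants M).onFormula φ).subst
    (Sum.elim (fun i => Term.var i) (fun i => (L.con (b i)).term))

section Structures

variable {U : Type w} [L.Structure U]

/-- `κ`-saturation: every complete `1`-type over a parameter set of size `< κ` is realised. -/
def IsSaturated (L : Language.{u, v}) (κ : Cardinal.{w}) (U : Type w) [L.Structure U] : Prop :=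
  ∀ A : Set U, #A < κ → ∀ r : TypeOver L A (Fin 1),
    ∃ c : Fin 1 → U, ∀ φ ∈ formulas r, φ.Realize c

/-- `κ`-strong homogeneity: every partial elementary map from a set of size `< κ` extends to an
automorphism. -/
def IsStronglyHomogeneous (L : Language.{u, v}) (κ : Cardinal.{w}) (U : Type w) [L.Structure U] :
    Prop :=
  ∀ A : Set U, #A < κ → ∀ f : A → U,
    (∀ φ : L.Formula A, φ.Realize ((↑) : A → U) ↔ φ.Realize f) →
      ∃ σ : U ≃[L] U, ∀ a : A, σ a = f a

/-- `A`-invariance of a global type: if `b ≡_A c` then `φ(x; b) ∈ p ↔ φ(x; c) ∈ p`. -/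
def IsInvariantOver (A : Set U) {α : Type w'} (p : GlobalType L U α) : Prop :=
  ∀ (n : ℕ) (φ : L.Formula (α ⊕ Fin n)) (b c : Fin n → U),
    (∀ ψ : L[[A]].Formula (Fin n), ψ.Realize b ↔ ψ.Realize c) →
      (instantiate φ b ∈ formulas p ↔ instantiate φ c ∈ formulas p)

variable {α β : Type w'}

/-- `r ∈ S_{pq}(A)`: the type `r(x, y)` over `A` contains `p ↾ A` and `q ↾ A`. -/
structure IsJoint {A : Set U} (p : GlobalType L U α) (q : GlobalType L U β)
    (r : TypeOver L A (α ⊕ β)) : Prop where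
  left : ∀ φ : L[[A]].Formula α, inclTop φ ∈ formulas p → φ.relabel Sum.inl ∈ formulas r
  right : ∀ φ : L[[A]].Formula β, inclTop φ ∈ formulas q → φ.relabel Sum.inr ∈ formulas r

/-- The partial global type `p(x) ∪ r(x, y)`. -/
def unionLeft {A : Set U} (p : GlobalType L U α) (r : TypeOver L A (α ⊕ β)) :
    Set (L[[U]].Formula (α ⊕ β)) :=
  (fun φ => φ.relabel Sum.inl) '' formulas p ∪ inclTop '' formulas r

/-- The partial global type `q(y) ∪ r(x, y)`. -/
def unionRight {A : Set U} (q : GlobalType L U β) (r : TypeOver L A (α ⊕ β)) :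
    Set (L[[U]].Formula (α ⊕ β)) :=
  (fun φ => φ.relabel Sum.inr) '' formulas q ∪ inclTop '' formulas r

/-- `p(x) ∪ r(x, y) ⊢ q(y)`. -/
def EntailsRight {A : Set U} (p : GlobalType L U α) (r : TypeOver L A (α ⊕ β))
    (q : GlobalType L U β) : Prop :=
  ∀ ψ ∈ formulas q, Entails (L.elementaryDiagram U) (unionLeft p r) (ψ.relabel Sum.inr)

/-- `q(y) ∪ r(x, y) ⊢ p(x)`. -/
def EntailsLeft {A : Set U} (q : GlobalType L U β) (r : TypeOver L A (α ⊕ β))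
    (p : GlobalType L U α) : Prop :=
  ∀ φ ∈ formulas p, Entails (L.elementaryDiagram U) (unionRight q r) (φ.relabel Sum.inl)

/-- Domination `p ≥_D q`: there are a small `A` and some `r ∈ S_{pq}(A)` with `p ∪ r ⊢ q`. -/
def Dominates (κ : Cardinal.{w}) (p : GlobalType L U α) (q : GlobalType L U β) : Prop :=
  ∃ A : Set U, #A < κ ∧ ∃ r : TypeOver L A (α ⊕ β), IsJoint p q r ∧ EntailsRight p r q

/-- The tuple `a` of the elementary extension `j : U ↪ₑ N` realises the global type `p`. -/
def Realises {N : Type w} [L.Structure N] (j : U ↪ₑ[L] N) (a : α → N) (p : GlobalType L U α) :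
    Prop :=
  letI : (constantsOn U).Structure N := constantsOn.structure j
  ∀ φ ∈ formulas p, φ.Realize a

/-- `tp(a/B)`. -/
noncomputable def tp {N : Type w} [L.Structure N] [Nonempty N] (a : α → N) (B : Set N) :
    TypeOver L B α :=
  (L[[B]].completeTheory N).typeOf a

/-- Shelah's `F^s_κ`-isolation: a complete type `t` over `B` is `F^s_κ`-isolated if there is
`A ⊆ B` with `|A| < κ` and `t ↾ A ⊢ t`. -/
def IsFsIsolated (κ : Cardinal.{w}) {N : Type w} [L.Structure N] {B : Set N}
    (t : TypeOver L B α) : Prop :=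
  ∃ (A : Set N) (h : A ⊆ B), #A < κ ∧
    ∀ φ ∈ formulas t,
      Entails (L[[B]].completeTheory N) {ψ ∈ formulas t | ∃ χ, inclSet h χ = ψ} φ

end Structures

end General

/-! ### The language and the class of finite structures

The two-sorted language is coded in the usual way by a one-sorted language with two unary
predicates for the sorts; the sorts partition the universe and the other symbols hold only for
arguments of the correct sorts. -/

/-- Relation symbols: the sorts `O` and `D`, the relation `E` on `O²`, the predicate `P` on `O`,
and the relation `R` on `O² × D`. -/
inductive Rel : ℕ → Type
  | obj : Rel 1
  | dig : Rel 1
  | eqv : Rel 2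
  | prd : Rel 1
  | arr : Rel 3

/-- The (relational) language. -/
abbrev LOD : Language.{0, 0} := ⟨fun _ => Empty, Rel⟩

section Interpretations

variable {N : Type w} [LOD.Structure N]

/-- `x` is of sort `O`. -/
def Obj (x : N) : Prop := Structure.RelMap (L := LOD) Rel.obj ![x]

/-- `x` is of sort `D`. -/
def Dig (x : N) : Prop := Structure.RelMap (L := LOD) Rel.dig ![x]

/-- `E(x, y)`. -/
def Eqv (x y : N) : Prop := Structure.RelMap (L := LOD) Rel.eqv ![x, y]

/-- `P(x)`. -/
def Prd (x : N) : Prop := Structure.RelMap (L := LOD) Rel.prd ![x]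

/-- `R(x, y, d)`. -/
def Arr (x y d : N) : Prop := Structure.RelMap (L := LOD) Rel.arr ![x, y, d]

end Interpretations

/-- The universal axioms. -/
structure SatisfiesAxioms (N : Type w) [LOD.Structure N] : Prop where
  /-- The sorts partition the universe. -/
  dig_iff : ∀ x : N, Dig x ↔ ¬ Obj x
  eqv_sort : ∀ x y : N, Eqv x y → Obj x ∧ Obj y
  prd_sort : ∀ x : N, Prd x → Obj x
  arr_sort : ∀ x y d : N, Arr x y d → Obj x ∧ Obj y ∧ Dig d
  /-- `E` is an equivalence relation on `O`. -/
  eqv_refl : ∀ x : N, Obj x → Eqv x x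
  eqv_symm : ∀ x y : N, Eqv x y → Eqv y x
  eqv_trans : ∀ x y z : N, Eqv x y → Eqv y z → Eqv x z
  arr_eqv : ∀ x y d : N, Arr x y d → Eqv x y
  arr_asymm : ∀ x y d : N, Arr x y d → ¬ Arr y x d

/-- The class of finite structures satisfying the axioms. -/
def finiteClass : Set (CategoryTheory.Bundled.{0} LOD.Structure) :=
  {S | Finite S ∧ SatisfiesAxioms S}

/-- The structure satisfies the axioms, `E` has infinitely many classes, `P` is infinite and
coinfinite on each class, and the digraphs are random on each class and independent of `P` and of
each other. -/
structure IsGeneric (N : Type w) [LOD.Structure N] : Prop extends SatisfiesAxioms N where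
  infinite_classes : {C : Set N | ∃ x, Obj x ∧ C = {y | Eqv x y}}.Infinite
  infinite_prd : ∀ x : N, Obj x → {y | Eqv x y ∧ Prd y}.Infinite
  infinite_not_prd : ∀ x : N, Obj x → {y | Eqv x y ∧ ¬ Prd y}.Infinite
  /-- Given finitely many points `F` of the class of `c` and finitely many digraphs `W`, the class
  contains a new point in or out of `P` as prescribed, and joined to every point of `F` in every
  digraph of `W` as prescribed. -/
  extend_obj : ∀ (c : N), Obj c → ∀ F W : Finset N, (∀ y ∈ F, Eqv c y) → (∀ d ∈ W, Dig d) →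
    ∀ (inP : Prop) (out inn : N → N → Prop), (∀ y d, ¬ (out y d ∧ inn y d)) →
      ∃ x, Eqv c x ∧ x ∉ F ∧ (Prd x ↔ inP) ∧
        ∀ y ∈ F, ∀ d ∈ W, (Arr x y d ↔ out y d) ∧ (Arr y x d ↔ inn y d)
  /-- Every digraph on a finite set of objects, without edges across distinct classes, is induced
  by infinitely many points of `D`. -/
  extend_dig : ∀ F : Finset N, (∀ y ∈ F, Obj y) → ∀ S : N → N → Prop,
    (∀ y ∈ F, ∀ z ∈ F, S y z → Eqv y z ∧ ¬ S z y) →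
      {d | Dig d ∧ ∀ y ∈ F, ∀ z ∈ F, (Arr y z d ↔ S y z)}.Infinite

/-! ### The types -/

section Types

variable (U : Type w) [LOD.Structure U]

/-- The formula `O(x)` over `U`. -/
def objFormula : LOD[[U]].Formula (Fin 1) :=
  (LOD.lhomWithConstants U).onFormula (Relations.formula₁ (L := LOD) Rel.obj (Term.var 0))

/-- The formula `P(x)` over `U`. -/
def prdFormula : LOD[[U]].Formula (Fin 1) :=
  (LOD.lhomWithConstants U).onFormula (Relations.formula₁ (L := LOD) Rel.prd (Term.var 0))

variable {U} in
/-- The formula `¬ E(x, d)` over `U`. -/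
def notEqvFormula (d : U) : LOD[[U]].Formula (Fin 1) :=
  ∼(Relations.formula₂ ((LOD.lhomWithConstants U).onRelation Rel.eqv)
    (Term.var 0) (LOD.con d).term)

/-- `π(x) = {¬ E(x, d) | d ∈ O(U)}`, with `x` of sort `O`. -/
def newClass : Set (LOD[[U]].Formula (Fin 1)) :=
  {objFormula U} ∪ {φ | ∃ d : U, Obj d ∧ φ = notEqvFormula d}

/-- The partial type `π(x) ∪ {P(x)}`. -/
def newClassPrd : Set (LOD[[U]].Formula (Fin 1)) := newClass U ∪ {prdFormula U}

/-- The partial type `π(x) ∪ {¬ P(x)}`. -/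
def newClassNotPrd : Set (LOD[[U]].Formula (Fin 1)) := newClass U ∪ {∼(prdFormula U)}

/-- The formula `ρ(x, y) = E(x, y) ∧ P(x) ∧ ¬ P(y)`, as a formula without parameters. -/
def rho : LOD[[(∅ : Set U)]].Formula (Fin 1 ⊕ Fin 1) :=
  (LOD.lhomWithConstants (∅ : Set U)).onFormula
    (Relations.formula₂ (L := LOD) Rel.eqv (Term.var (Sum.inl 0)) (Term.var (Sum.inr 0)) ⊓
      (Relations.formula₁ (L := LOD) Rel.prd (Term.var (Sum.inl 0)) ⊓
        ∼(Relations.formula₁ (L := LOD) Rel.prd (Term.var (Sum.inr 0)))))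

/-- The formula `E(x, y)`, as a formula over `A`. -/
def eqvFormula {U : Type w} [LOD.Structure U] (A : Set U) : LOD[[A]].Formula (Fin 1 ⊕ Fin 1) :=
  (LOD.lhomWithConstants A).onFormula
    (Relations.formula₂ (L := LOD) Rel.eqv (Term.var (Sum.inl 0)) (Term.var (Sum.inr 0)))

/-- The formula `R(x, y, d)`. -/
def arrFormula {U : Type w} [LOD.Structure U] (d : U) : LOD[[U]].Formula (Fin 1 ⊕ Fin 1) :=
  Relations.formula ((LOD.lhomWithConstants U).onRelation Rel.arr)
    ![Term.var (Sum.inl 0), Term.var (Sum.inr 0), (LOD.con d).term]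

/-- The partial type `Γ(x, y)` decides whether `R(x, y, d)` holds, modulo the elementary diagram. -/
def DecidesArr {U : Type w} [LOD.Structure U] (Γ : Set (LOD[[U]].Formula (Fin 1 ⊕ Fin 1)))
    (d : U) : Prop :=
  Entails (LOD.elementaryDiagram U) Γ (arrFormula d) ∨
    Entails (LOD.elementaryDiagram U) Γ (∼(arrFormula d))

end Types

end FirstOrder.Domination

open FirstOrder.Domination

universe u

/-! Everything is reduced to atomic types. A structure satisfying the axioms can always be enlarged
by one object, in an old or a new class, with any asymmetric choice of `R` towards its class, or by
one point of `D` carrying any digraph inside the classes (`SatisfiesAxioms.exists_new_obj`,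
`SatisfiesAxioms.exists_new_dig`). A structure `Gen` on ℕ realising every legal one-point extension
of a finite tuple (`exists_extension_gen`) is therefore the Fraïssé limit. One-point extension is
first order, so it holds in every model of the theory and yields quantifier elimination by
back-and-forth (`AtomEq.realize_iff`). Conversely, every structure satisfying the axioms embeds in a
model (`exists_model_extending`), so a type is shown consistent by writing down a structure.

An object whose class misses `U` has no instance of `E` or `R` with elements of `U`; only `P`
remains to be decided, which makes `p` and `q` complete and invariant (`AtomEq.elim_new`). If `E(x,
y)`, then `x` lies in a new class exactly when `y` does, so `rho` leads from each type to the other.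

On the other hand, for `x`, `y` in a common new class the truth of `R(x, y, d)` is free for each
`d`. A type over a small `A` controls only the `d` in `A`, and saturation supplies one outside
(`exists_pair_extending`). The same freedom refutes isolation over a small `A`: if `E(a, b)`, the
value of `R(a, b, d)` can be flipped at some `d` outside `A`; otherwise `a` can be replaced by a
point in the class of an element of `U` inequivalent to all of `A`. -/

namespace FirstOrder.Domination

/-! ### Satisfaction of formulas along a map naming the parameters -/

section Bridge

universe v w w' w''

variable {L : Language.{u, v}} {A : Type w} {α : Type w'} {N : Type w''} [L.Structure N]

/-- `φ(x)` holds in `N` when the constants naming the elements of `A` are interpreted by `c`. -/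
def Sat (c : A → N) (x : α → N) (φ : L[[A]].Formula α) : Prop :=
  letI : (constantsOn A).Structure N := constantsOn.structure c
  φ.Realize x

/-- The map `c` is elementary relative to the interpretation `c₀` of the same names. -/
def Elem (L : Language.{u, v}) {V : Type*} [L.Structure V] [L.Structure N] (c₀ : A → V)
    (c : A → N) : Prop :=
  ∀ ψ : L.Formula A, ψ.Realize c₀ ↔ ψ.Realize c

/-- Trading constants for variables makes a condition over `A` a parameter-free one on the joint
tuple `Sum.elim c x`, to which quantifier elimination applies. -/
theorem sat_iff_constantsVarsEquiv (c : A → N) (x : α → N) (φ : L[[A]].Formula α) :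
    Sat c x φ ↔
      Formula.Realize (BoundedFormula.constantsVarsEquiv φ : L.Formula (A ⊕ α))
        (Sum.elim c x) := by
  let : (constantsOn A).Structure N := constantsOn.structure c
  exact (BoundedFormula.realize_constantsVarsEquiv (φ := φ) (v := x) (xs := default)).symm

theorem realize_iff_sat [L[[A]].Structure N] [(L.lhomWithConstants A).IsExpansionOn N]
    (x : α → N) (φ : L[[A]].Formula α) :
    φ.Realize x ↔ Sat (fun a => (L.con a : N)) x φ := by
  rw [sat_iff_constantsVarsEquiv]
  exact (BoundedFormula.realize_constantsVarsEquiv (φ := φ) (v := x) (xs := default)).symm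

@[simp]
theorem sat_not (c : A → N) (x : α → N) (φ : L[[A]].Formula α) :
    Sat c x (∼φ) ↔ ¬ Sat c x φ := Iff.rfl

@[simp]
theorem sat_relabel {β : Type*} (c : A → N) (x : β → N) (g : α → β) (φ : L[[A]].Formula α) :
    Sat c x (φ.relabel g) ↔ Sat c (x ∘ g) φ :=
  letI : (constantsOn A).Structure N := constantsOn.structure c
  Formula.realize_relabel

@[simp]
theorem sat_onFormula (c : A → N) (x : α → N) (φ : L.Formula α) :
    Sat c x ((L.lhomWithConstants A).onFormula φ) ↔ φ.Realize x :=
  letI : (constantsOn A).Structure N := constantsOn.structure c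
  LHom.realize_onFormula _ _

theorem sat_onFormula_map {B : Type*} (f : A → B) (c : B → N) (x : α → N)
    (φ : L[[A]].Formula α) :
    Sat c x ((L.lhomWithConstantsMap f).onFormula φ) ↔ Sat (c ∘ f) x φ := by
  let : (constantsOn A).Structure N := constantsOn.structure (c ∘ f)
  let : (constantsOn B).Structure N := constantsOn.structure c
  have : (LHom.constantsOnMap f).IsExpansionOn N := constantsOnMap_isExpansionOn rfl
  have : (L.lhomWithConstantsMap f).IsExpansionOn N := LHom.sumMap_isExpansionOn _ _ _
  exact LHom.realize_onFormula _ _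

@[simp]
theorem realize_con_term (c : A → N) (x : α → N) (a : A) :
    letI : (constantsOn A).Structure N := constantsOn.structure c
    ((L.con a).term : L[[A]].Term α).realize x = c a := by
  let : (constantsOn A).Structure N := constantsOn.structure c
  exact Term.realize_constants

theorem sat_instantiate {U : Type w} [L.Structure U] {n : ℕ} (c : U → N) (x : α → N)
    (φ : L.Formula (α ⊕ Fin n)) (b : Fin n → U) :
    Sat c x (instantiate φ b) ↔ φ.Realize (Sum.elim x (c ∘ b)) := by
  let : (constantsOn U).Structure N := constantsOn.structure c
  have h : (fun i => (Sum.elim (fun i => Term.var i) (fun i => (L.con (b i)).term) i :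
      L[[U]].Term α).realize x) = Sum.elim x (c ∘ b) := by
    funext i
    rcases i with i | i
    · rfl
    · exact realize_con_term c x (b i)
  unfold Sat instantiate
  rw [Formula.Realize, BoundedFormula.realize_subst, h]
  exact LHom.realize_onFormula _ φ

section Elementary

variable {V : Type*} [L.Structure V]

theorem Elem.realize_sentence {c₀ : A → V} {c : A → N} (h : Elem L c₀ c) (φ : L.Sentence) :
    V ⊨ φ ↔ N ⊨ φ := by
  have := h (φ.relabel Empty.elim)
  rw [Formula.realize_relabel, Formula.realize_relabel] at this
  simpa [Sentence.Realize, Subsingleton.elim _ (default : Empty → _)] using this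

theorem sat_equivSentence (c : A → N) (ψ : L.Formula A) :
    Sat c default (Formula.equivSentence ψ) ↔ ψ.Realize c :=
  letI : (constantsOn A).Structure N := constantsOn.structure c
  Formula.realize_equivSentence N ψ

theorem Elem.sat_iff {c₀ : A → V} {c : A → N} (h : Elem L c₀ c) (φ : L[[A]].Sentence) :
    Sat c₀ default φ ↔ Sat c default φ := by
  obtain ⟨ψ, rfl⟩ := Formula.equivSentence.surjective φ
  rw [sat_equivSentence, sat_equivSentence]
  exact h ψ

variable [L[[A]].Structure V] [(L.lhomWithConstants A).IsExpansionOn V]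

theorem Elem.model {c : A → N} (h : Elem L (fun a => (L.con a : V)) c) :
    letI : (constantsOn A).Structure N := constantsOn.structure c
    N ⊨ L[[A]].completeTheory V := by
  let : (constantsOn A).Structure N := constantsOn.structure c
  refine ⟨fun φ hφ => ?_⟩
  have h1 : V ⊨ φ := hφ
  have h2 := (h.sat_iff φ).1 ((realize_iff_sat (N := V) default φ).1 h1)
  exact h2

theorem elem_of_model [L[[A]].Structure N] [(L.lhomWithConstants A).IsExpansionOn N]
    [hN : N ⊨ L[[A]].completeTheory V] :
    Elem L (fun a : A => (L.con a : V)) (fun a : A => (L.con a : N)) := by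
  intro ψ
  rw [← Formula.realize_equivSentence, ← Formula.realize_equivSentence]
  exact (realize_iff_of_model_completeTheory V N _).symm

end Elementary

end Bridge

/-! ### Entailment and complete types in semantic form -/

section Types

universe w

variable {L : Language.{0, 0}} {A V : Type u} {α : Type} [L.Structure V]
  [L[[A]].Structure V] [(L.lhomWithConstants A).IsExpansionOn V]

/-- A model of the complete theory over `A` amounts to an `L`-structure with an elementary map on
the names, so later arguments may choose `N` and `c` directly. -/
theorem entails_iff {Γ : Set (L[[A]].Formula α)} {φ : L[[A]].Formula α} :
    Entails (L[[A]].completeTheory V) Γ φ ↔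
      ∀ (N : Type u) [L.Structure N] [Nonempty N] (c : A → N),
        Elem L (fun a => (L.con a : V)) c →
          ∀ x : α → N, (∀ ψ ∈ Γ, Sat c x ψ) → Sat c x φ := by
  constructor
  · intro h N _ _ c hc x hx
    let : (constantsOn A).Structure N := constantsOn.structure c
    have := hc.model
    exact h (Theory.ModelType.of _ N) x hx
  · intro h N x hx
    let : L.Structure N := (L.lhomWithConstants A).reduct N
    have : (L.lhomWithConstants A).IsExpansionOn N := LHom.isExpansionOn_reduct _ _
    rw [realize_iff_sat]
    refine h N _ elem_of_model x fun ψ hψ => ?_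
    rw [← realize_iff_sat]
    exact hx ψ hψ

theorem completeType_ext {T : L[[A]].Theory} {p q : T.CompleteType α}
    (h : formulas p = formulas q) : p = q := by
  refine SetLike.ext fun φ => ?_
  obtain ⟨ψ, rfl⟩ := Formula.equivSentence.surjective φ
  exact Set.ext_iff.1 h ψ

theorem exists_formulas_eq_sat (p : (L[[A]].completeTheory V).CompleteType α) :
    ∃ (N : Type u) (_ : L.Structure N) (_ : Nonempty N) (c : A → N) (x : α → N),
      Elem L (fun a => (L.con a : V)) c ∧ formulas p = {φ | Sat c x φ} := by
  obtain ⟨N, x, hx⟩ := Theory.exists_modelType_is_realized_in _ p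
  let : L.Structure N := (L.lhomWithConstants A).reduct N
  have : (L.lhomWithConstants A).IsExpansionOn N := LHom.isExpansionOn_reduct _ _
  refine ⟨N, inferInstance, inferInstance, _, x, elem_of_model, ?_⟩
  ext φ
  rw [← hx]
  refine (Theory.CompleteType.formula_mem_typeOf (T := L[[A]].completeTheory V) (v := x)).trans ?_
  exact realize_iff_sat _ _

theorem exists_completeType {N : Type w} [L.Structure N] [Nonempty N] {c : A → N}
    (hc : Elem L (fun a => (L.con a : V)) c) (x : α → N) :
    ∃ p : (L[[A]].completeTheory V).CompleteType α, formulas p = {φ | Sat c x φ} := by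
  let : (constantsOn A).Structure N := constantsOn.structure c
  have := hc.model
  refine ⟨(L[[A]].completeTheory V).typeOf x, ?_⟩
  ext φ
  exact Theory.CompleteType.formula_mem_typeOf (T := L[[A]].completeTheory V) (v := x)

theorem formulas_tp {N : Type u} [L.Structure N] [Nonempty N] (a : α → N) (B : Set N) :
    formulas (tp (L := L) a B) = {φ | Sat ((↑) : B → N) a φ} := by
  ext φ
  exact Theory.CompleteType.formula_mem_typeOf (T := L[[B]].completeTheory N) (v := a)

theorem mem_formulas_not {T : L[[A]].Theory} {p : T.CompleteType α} {φ : L[[A]].Formula α} :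
    ∼φ ∈ formulas p ↔ φ ∉ formulas p := by
  change Formula.equivSentence φ.not ∈ p ↔ _
  rw [Formula.equivSentence_not]
  exact p.not_mem_iff _

end Types

/-! ### Atomic types and their one-point extensions -/

section AtomicTypes

variable {α β N N₁ N₂ N₃ : Type*} [LOD.Structure N] [LOD.Structure N₁] [LOD.Structure N₂]
  [LOD.Structure N₃]

theorem comp_fin_one (f : α → β) (t : Fin 1 → α) : f ∘ t = ![f (t 0)] := by
  ext i; fin_cases i; rfl

theorem comp_fin_two (f : α → β) (t : Fin 2 → α) : f ∘ t = ![f (t 0), f (t 1)] := by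
  ext i; fin_cases i <;> rfl

theorem comp_fin_three (f : α → β) (t : Fin 3 → α) :
    f ∘ t = ![f (t 0), f (t 1), f (t 2)] := by
  ext i; fin_cases i <;> rfl

/-- The formula `O(t)`. -/
abbrev objF (t : LOD.Term α) : LOD.Formula α := Relations.formula₁ (L := LOD) Rel.obj t

/-- The formula `D(t)`. -/
abbrev digF (t : LOD.Term α) : LOD.Formula α := Relations.formula₁ (L := LOD) Rel.dig t

/-- The formula `P(t)`. -/
abbrev prdF (t : LOD.Term α) : LOD.Formula α := Relations.formula₁ (L := LOD) Rel.prd t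

/-- The formula `E(t₁, t₂)`. -/
abbrev eqvF (t₁ t₂ : LOD.Term α) : LOD.Formula α := Relations.formula₂ (L := LOD) Rel.eqv t₁ t₂

/-- The formula `R(t₁, t₂, t₃)`. -/
abbrev arrF (t₁ t₂ t₃ : LOD.Term α) : LOD.Formula α :=
  Relations.formula (L := LOD) Rel.arr ![t₁, t₂, t₃]

theorem realize_obj {v : α → N} {t : LOD.Term α} : (objF t).Realize v ↔ Obj (t.realize v) :=
  Formula.realize_rel₁

theorem realize_dig {v : α → N} {t : LOD.Term α} : (digF t).Realize v ↔ Dig (t.realize v) :=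
  Formula.realize_rel₁

theorem realize_prd {v : α → N} {t : LOD.Term α} : (prdF t).Realize v ↔ Prd (t.realize v) :=
  Formula.realize_rel₁

theorem realize_eqv {v : α → N} {t₁ t₂ : LOD.Term α} :
    (eqvF t₁ t₂).Realize v ↔ Eqv (t₁.realize v) (t₂.realize v) :=
  Formula.realize_rel₂

theorem realize_arr {v : α → N} {t₁ t₂ t₃ : LOD.Term α} :
    (arrF t₁ t₂ t₃).Realize v ↔ Arr (t₁.realize v) (t₂.realize v) (t₃.realize v) := by
  rw [Formula.realize_rel, Arr, iff_iff_eq]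
  congr 1
  funext i
  fin_cases i <;> rfl

/-- The tuples `f` and `g` have the same atomic type. -/
structure AtomEq (f : α → N₁) (g : α → N₂) : Prop where
  eq : ∀ i j, f i = f j ↔ g i = g j
  obj : ∀ i, Obj (f i) ↔ Obj (g i)
  dig : ∀ i, Dig (f i) ↔ Dig (g i)
  prd : ∀ i, Prd (f i) ↔ Prd (g i)
  eqv : ∀ i j, Eqv (f i) (f j) ↔ Eqv (g i) (g j)
  arr : ∀ i j k, Arr (f i) (f j) (f k) ↔ Arr (g i) (g j) (g k)

namespace AtomEq

theorem refl (f : α → N) : AtomEq f f := by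
  constructor <;> intros <;> rfl

theorem symm {f : α → N₁} {g : α → N₂} (h : AtomEq f g) : AtomEq g f where
  eq i j := (h.eq i j).symm
  obj i := (h.obj i).symm
  dig i := (h.dig i).symm
  prd i := (h.prd i).symm
  eqv i j := (h.eqv i j).symm
  arr i j k := (h.arr i j k).symm

theorem trans {f : α → N₁} {g : α → N₂} {k : α → N₃} (h : AtomEq f g) (h' : AtomEq g k) :
    AtomEq f k where
  eq i j := (h.eq i j).trans (h'.eq i j)
  obj i := (h.obj i).trans (h'.obj i)
  dig i := (h.dig i).trans (h'.dig i)
  prd i := (h.prd i).trans (h'.prd i)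
  eqv i j := (h.eqv i j).trans (h'.eqv i j)
  arr i j l := (h.arr i j l).trans (h'.arr i j l)

theorem comp {f : α → N₁} {g : α → N₂} (h : AtomEq f g) (k : β → α) :
    AtomEq (f ∘ k) (g ∘ k) where
  eq _ _ := h.eq _ _
  obj _ := h.obj _
  dig _ := h.dig _
  prd _ := h.prd _
  eqv _ _ := h.eqv _ _
  arr _ _ _ := h.arr _ _ _

theorem of_isEmpty [IsEmpty α] (f : α → N₁) (g : α → N₂) : AtomEq f g := by
  constructor <;> intro i <;> exact isEmptyElim i

theorem relMap {f : α → N₁} {g : α → N₂} (h : AtomEq f g) {n : ℕ} (R : LOD.Relations n)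
    (t : Fin n → α) :
    Structure.RelMap R (f ∘ t) ↔ Structure.RelMap R (g ∘ t) := by
  rcases R with _ | _ | _ | _ | _
  · rw [comp_fin_one f, comp_fin_one g]; exact h.obj _
  · rw [comp_fin_one f, comp_fin_one g]; exact h.dig _
  · rw [comp_fin_two f, comp_fin_two g]; exact h.eqv _ _
  · rw [comp_fin_one f, comp_fin_one g]; exact h.prd _
  · rw [comp_fin_three f, comp_fin_three g]; exact h.arr _ _ _

/-- Tuples satisfying the same formulas have the same atomic type. -/
theorem of_realize {f : α → N₁} {g : α → N₂}
    (h : ∀ φ : LOD.Formula α, φ.Realize f ↔ φ.Realize g) : AtomEq f g where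
  eq i j := by
    simpa [Formula.realize_equal] using h (Term.equal (Term.var i) (Term.var j))
  obj i := realize_obj.symm.trans ((h (objF (Term.var i))).trans realize_obj)
  dig i := realize_dig.symm.trans ((h (digF (Term.var i))).trans realize_dig)
  prd i := realize_prd.symm.trans ((h (prdF (Term.var i))).trans realize_prd)
  eqv i j :=
    realize_eqv.symm.trans ((h (eqvF (Term.var i) (Term.var j))).trans realize_eqv)
  arr i j k :=
    realize_arr.symm.trans
      ((h (arrF (Term.var i) (Term.var j) (Term.var k))).trans realize_arr)

end AtomEq

/-- The axioms are universal in at most three variables, so they can be tested on triples. -/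
theorem SatisfiesAxioms.of_forall_atomEq (hN : SatisfiesAxioms N₂)
    (h : ∀ x : Fin 3 → N₁, ∃ y : Fin 3 → N₂, AtomEq x y) : SatisfiesAxioms N₁ := by
  have key : ∀ x y z : N₁, ∃ w : Fin 3 → N₂, AtomEq ![x, y, z] w := fun x y z => h _
  constructor
  · intro x
    obtain ⟨w, hw⟩ := key x x x
    exact (hw.dig 0).trans ((hN.dig_iff _).trans (not_congr (hw.obj 0).symm))
  · intro x y hxy
    obtain ⟨w, hw⟩ := key x y x
    have := hN.eqv_sort _ _ ((hw.eqv 0 1).1 hxy)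
    exact ⟨(hw.obj 0).2 this.1, (hw.obj 1).2 this.2⟩
  · intro x hx
    obtain ⟨w, hw⟩ := key x x x
    exact (hw.obj 0).2 (hN.prd_sort _ ((hw.prd 0).1 hx))
  · intro x y d hd
    obtain ⟨w, hw⟩ := key x y d
    have := hN.arr_sort _ _ _ ((hw.arr 0 1 2).1 hd)
    exact ⟨(hw.obj 0).2 this.1, (hw.obj 1).2 this.2.1, (hw.dig 2).2 this.2.2⟩
  · intro x hx
    obtain ⟨w, hw⟩ := key x x x
    exact (hw.eqv 0 0).2 (hN.eqv_refl _ ((hw.obj 0).1 hx))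
  · intro x y hxy
    obtain ⟨w, hw⟩ := key x y x
    exact (hw.eqv 1 0).2 (hN.eqv_symm _ _ ((hw.eqv 0 1).1 hxy))
  · intro x y z hxy hyz
    obtain ⟨w, hw⟩ := key x y z
    exact (hw.eqv 0 2).2 (hN.eqv_trans _ _ _ ((hw.eqv 0 1).1 hxy) ((hw.eqv 1 2).1 hyz))
  · intro x y d hd
    obtain ⟨w, hw⟩ := key x y d
    exact (hw.eqv 0 1).2 (hN.arr_eqv _ _ _ ((hw.arr 0 1 2).1 hd))
  · intro x y d hd hd'
    obtain ⟨w, hw⟩ := key x y d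
    exact hN.arr_asymm _ _ _ ((hw.arr 0 1 2).1 hd) ((hw.arr 1 0 2).1 hd')

theorem SatisfiesAxioms.of_atomEq (hN : SatisfiesAxioms N₂) {g : N₁ → N₂}
    (h : AtomEq g (id : N₁ → N₁)) : SatisfiesAxioms N₁ :=
  hN.of_forall_atomEq fun x => ⟨g ∘ x, (h.comp x).symm⟩

namespace SatisfiesAxioms

theorem not_obj_of_dig (hN : SatisfiesAxioms N) {d : N} (hd : Dig d) : ¬ Obj d :=
  (hN.dig_iff d).1 hd

theorem not_dig_of_obj (hN : SatisfiesAxioms N) {x : N} (hx : Obj x) : ¬ Dig x :=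
  fun h => hN.not_obj_of_dig h hx

theorem eqv_comm (hN : SatisfiesAxioms N) {x y : N} : Eqv x y ↔ Eqv y x :=
  ⟨hN.eqv_symm _ _, hN.eqv_symm _ _⟩

theorem not_arr_self (hN : SatisfiesAxioms N) (x d : N) : ¬ Arr x x d :=
  fun h => hN.arr_asymm _ _ _ h h

end SatisfiesAxioms

/-- Atomic types are extended by a new object once its relations to the tuple agree. -/
theorem AtomEq.elim_obj (h₁ : SatisfiesAxioms N₁) (h₂ : SatisfiesAxioms N₂)
    {f : α → N₁} {g : α → N₂} (h : AtomEq f g) {x : Fin 1 → N₁} {y : Fin 1 → N₂}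
    (hx : Obj (x 0)) (hy : Obj (y 0)) (hp : Prd (x 0) ↔ Prd (y 0))
    (hxf : ∀ i, x 0 ≠ f i) (hyg : ∀ i, y 0 ≠ g i)
    (he : ∀ i, Eqv (x 0) (f i) ↔ Eqv (y 0) (g i))
    (ho : ∀ i k, Arr (x 0) (f i) (f k) ↔ Arr (y 0) (g i) (g k))
    (hi : ∀ i k, Arr (f i) (x 0) (f k) ↔ Arr (g i) (y 0) (g k)) :
    AtomEq (Sum.elim f x) (Sum.elim g y) := by
  have dx := h₁.not_dig_of_obj hx
  have dy := h₂.not_dig_of_obj hy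
  constructor
  · rintro (i | i) (j | j)
    · exact h.eq i j
    · obtain rfl := Subsingleton.elim j 0
      exact iff_of_false (hxf i).symm (hyg i).symm
    · obtain rfl := Subsingleton.elim i 0
      exact iff_of_false (hxf j) (hyg j)
    · simp [Subsingleton.elim i j]
  · rintro (i | i)
    · exact h.obj i
    · obtain rfl := Subsingleton.elim i 0
      exact iff_of_true hx hy
  · rintro (i | i)
    · exact h.dig i
    · obtain rfl := Subsingleton.elim i 0
      exact iff_of_false dx dy
  · rintro (i | i)
    · exact h.prd i
    · obtain rfl := Subsingleton.elim i 0
      exact hp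
  · rintro (i | i) (j | j)
    · exact h.eqv i j
    · obtain rfl := Subsingleton.elim j 0
      exact h₁.eqv_comm.trans ((he i).trans h₂.eqv_comm)
    · obtain rfl := Subsingleton.elim i 0
      exact he j
    · obtain rfl := Subsingleton.elim i 0
      obtain rfl := Subsingleton.elim j 0
      exact iff_of_true (h₁.eqv_refl _ hx) (h₂.eqv_refl _ hy)
  · rintro i j (k | k)
    · rcases i with i | i <;> rcases j with j | j
      · exact h.arr i j k
      · obtain rfl := Subsingleton.elim j 0
        exact hi i k
      · obtain rfl := Subsingleton.elim i 0
        exact ho j k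
      · obtain rfl := Subsingleton.elim i 0
        obtain rfl := Subsingleton.elim j 0
        exact iff_of_false (h₁.not_arr_self _ _) (h₂.not_arr_self _ _)
    · obtain rfl := Subsingleton.elim k 0
      exact iff_of_false (fun h => dx (h₁.arr_sort _ _ _ h).2.2)
        fun h => dy (h₂.arr_sort _ _ _ h).2.2

/-- Atomic types are extended by a new point of `D` once its digraph on the tuple agrees. -/
theorem AtomEq.elim_dig (h₁ : SatisfiesAxioms N₁) (h₂ : SatisfiesAxioms N₂)
    {f : α → N₁} {g : α → N₂} (h : AtomEq f g) {x : Fin 1 → N₁} {y : Fin 1 → N₂}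
    (hx : Dig (x 0)) (hy : Dig (y 0))
    (hxf : ∀ i, x 0 ≠ f i) (hyg : ∀ i, y 0 ≠ g i)
    (ha : ∀ i k, Arr (f i) (f k) (x 0) ↔ Arr (g i) (g k) (y 0)) :
    AtomEq (Sum.elim f x) (Sum.elim g y) := by
  have dx := h₁.not_obj_of_dig hx
  have dy := h₂.not_obj_of_dig hy
  constructor
  · rintro (i | i) (j | j)
    · exact h.eq i j
    · obtain rfl := Subsingleton.elim j 0
      exact iff_of_false (hxf i).symm (hyg i).symm
    · obtain rfl := Subsingleton.elim i 0
      exact iff_of_false (hxf j) (hyg j)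
    · simp [Subsingleton.elim i j]
  · rintro (i | i)
    · exact h.obj i
    · obtain rfl := Subsingleton.elim i 0
      exact iff_of_false dx dy
  · rintro (i | i)
    · exact h.dig i
    · obtain rfl := Subsingleton.elim i 0
      exact iff_of_true hx hy
  · rintro (i | i)
    · exact h.prd i
    · obtain rfl := Subsingleton.elim i 0
      exact iff_of_false (fun h => dx (h₁.prd_sort _ h)) fun h => dy (h₂.prd_sort _ h)
  · rintro i (j | j)
    · rcases i with i | i
      · exact h.eqv i j
      · obtain rfl := Subsingleton.elim i 0
        exact iff_of_false (fun h => dx (h₁.eqv_sort _ _ h).1) fun h => dy (h₂.eqv_sort _ _ h).1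
    · obtain rfl := Subsingleton.elim j 0
      exact iff_of_false (fun h => dx (h₁.eqv_sort _ _ h).2) fun h => dy (h₂.eqv_sort _ _ h).2
  · rintro (i | i) (j | j) k
    · rcases k with k | k
      · exact h.arr i j k
      · obtain rfl := Subsingleton.elim k 0
        exact ha i j
    · obtain rfl := Subsingleton.elim j 0
      exact iff_of_false (fun h => dx (h₁.arr_sort _ _ _ h).2.1)
        fun h => dy (h₂.arr_sort _ _ _ h).2.1
    · obtain rfl := Subsingleton.elim i 0
      exact iff_of_false (fun h => dx (h₁.arr_sort _ _ _ h).1)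
        fun h => dy (h₂.arr_sort _ _ _ h).1
    · obtain rfl := Subsingleton.elim i 0
      exact iff_of_false (fun h => dx (h₁.arr_sort _ _ _ h).1)
        fun h => dy (h₂.arr_sort _ _ _ h).1

theorem AtomEq.elim_of_eq {f : α → N₁} {g : α → N₂} (h : AtomEq f g) (i : α) :
    AtomEq (Sum.elim f fun _ : Fin 1 => f i) (Sum.elim g fun _ : Fin 1 => g i) := by
  have h1 : (Sum.elim f fun _ : Fin 1 => f i) = f ∘ Sum.elim id fun _ => i := by
    ext (j | j) <;> rfl
  have h2 : (Sum.elim g fun _ : Fin 1 => g i) = g ∘ Sum.elim id fun _ => i := by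
    ext (j | j) <;> rfl
  rw [h1, h2]
  exact h.comp _

end AtomicTypes

/-! ### Adjoining one point to a structure satisfying the axioms -/

section Building

/-- The structure with the given relations. -/
@[reducible]
def structureOf {X : Type*} (obj dig prd : X → Prop) (eqv : X → X → Prop)
    (arr : X → X → X → Prop) : LOD.Structure X where
  funMap f := nomatch f
  RelMap {n} R t := match n, R, t with
    | _, Rel.obj, t => obj (t 0)
    | _, Rel.dig, t => dig (t 0)
    | _, Rel.eqv, t => eqv (t 0) (t 1)
    | _, Rel.prd, t => prd (t 0)
    | _, Rel.arr, t => arr (t 0) (t 1) (t 2)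

variable {N : Type*} [LOD.Structure N]

/-- A structure satisfying the axioms may be extended by a new object lying in a given class or in
a new one. -/
theorem SatisfiesAxioms.exists_new_obj (hN : SatisfiesAxioms N) (K : N → Prop)
    (hK : ∀ x y, K x → (K y ↔ Eqv x y)) (inP : Prop) (out inn : N → N → Prop)
    (hout : ∀ y d, out y d → K y ∧ Dig d) (hinn : ∀ y d, inn y d → K y ∧ Dig d)
    (hdisj : ∀ y d, ¬ (out y d ∧ inn y d)) :
    ∃ _ : LOD.Structure (Option N), SatisfiesAxioms (Option N) ∧
      AtomEq (some : N → Option N) (id : N → N) ∧ Obj (none : Option N) ∧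
      (Prd (none : Option N) ↔ inP) ∧ (∀ y : N, Eqv none (some y) ↔ K y) ∧
      (∀ y d : N, Arr none (some y) (some d) ↔ out y d) ∧
      ∀ y d : N, Arr (some y) none (some d) ↔ inn y d := by
  -- By `hK`, `K` is either empty, for a new class, or one whole `E`-class.
  have hKo : ∀ x, K x → Obj x := fun x hx => (hN.eqv_sort _ _ ((hK x x hx).1 hx)).1
  let str : LOD.Structure (Option N) := structureOf
    (fun x => x.elim True Obj) (fun x => x.elim False Dig) (fun x => x.elim inP Prd)
    (fun x y => x.elim (y.elim True K) fun x => y.elim (K x) (Eqv x))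
    (fun x y d => d.elim False fun d => x.elim (y.elim False fun y => out y d)
      fun x => y.elim (inn x d) fun y => Arr x y d)
  refine ⟨str, ?_, ?_, trivial, Iff.rfl, fun _ => Iff.rfl, fun _ _ => Iff.rfl,
    fun _ _ => Iff.rfl⟩
  · constructor
    · rintro (_ | x)
      · exact iff_of_false id (fun h => h trivial)
      · exact hN.dig_iff x
    · rintro (_ | x) (_ | y) h
      · exact ⟨trivial, trivial⟩
      · exact ⟨trivial, hKo y h⟩
      · exact ⟨hKo x h, trivial⟩
      · exact hN.eqv_sort x y h
    · rintro (_ | x) h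
      · trivial
      · exact hN.prd_sort x h
    · rintro (_ | x) (_ | y) (_ | d) h
      iterate 3 exact h.elim
      · exact ⟨trivial, hKo y (hout y d h).1, (hout y d h).2⟩
      · exact h.elim
      · exact ⟨hKo x (hinn x d h).1, trivial, (hinn x d h).2⟩
      · exact h.elim
      · exact hN.arr_sort x y d h
    · rintro (_ | x) h
      · trivial
      · exact hN.eqv_refl x h
    · rintro (_ | x) (_ | y) h
      · trivial
      · exact h
      · exact h
      · exact hN.eqv_symm x y h
    · rintro (_ | x) (_ | y) (_ | z) h h'
      · trivial
      · exact h'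
      · trivial
      · exact (hK y z h).2 h'
      · exact h
      · exact (hK x z h).1 h'
      · exact (hK y x h').2 (hN.eqv_symm _ _ h)
      · exact hN.eqv_trans x y z h h'
    · rintro (_ | x) (_ | y) (_ | d) h
      iterate 3 exact h.elim
      · exact (hout y d h).1
      · exact h.elim
      · exact (hinn x d h).1
      · exact h.elim
      · exact hN.arr_eqv x y d h
    · rintro (_ | x) (_ | y) (_ | d) h h'
      iterate 3 exact h.elim
      · exact hdisj y d ⟨h, h'⟩
      · exact h.elim
      · exact hdisj x d ⟨h', h⟩
      · exact h.elim
      · exact hN.arr_asymm x y d h h'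
  · exact ⟨fun _ _ => Option.some_inj, fun _ => Iff.rfl, fun _ => Iff.rfl, fun _ => Iff.rfl,
      fun _ _ => Iff.rfl, fun _ _ _ => Iff.rfl⟩

/-- A structure satisfying the axioms may be extended by a new point of `D`. -/
theorem SatisfiesAxioms.exists_new_dig (hN : SatisfiesAxioms N) (S : N → N → Prop)
    (hS : ∀ y z, S y z → Eqv y z ∧ ¬ S z y) :
    ∃ _ : LOD.Structure (Option N), SatisfiesAxioms (Option N) ∧
      AtomEq (some : N → Option N) (id : N → N) ∧ Dig (none : Option N) ∧
      ∀ y z : N, Arr (some y) (some z) none ↔ S y z := by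
  let str : LOD.Structure (Option N) := structureOf
    (fun x => x.elim False Obj) (fun x => x.elim True Dig) (fun x => x.elim False Prd)
    (fun x y => x.elim False fun x => y.elim False (Eqv x))
    (fun x y d => x.elim False fun x => y.elim False fun y => d.elim (S x y) (Arr x y))
  refine ⟨str, ?_, ?_, trivial, fun _ _ => Iff.rfl⟩
  · constructor
    · rintro (_ | x)
      · exact iff_of_true trivial id
      · exact hN.dig_iff x
    · rintro (_ | x) (_ | y) h
      iterate 3 exact h.elim
      exact hN.eqv_sort x y h
    · rintro (_ | x) h
      · exact h.elim
      · exact hN.prd_sort x h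
    · rintro (_ | x) (_ | y) (_ | d) h
      iterate 6 exact h.elim
      · have := hN.eqv_sort _ _ (hS x y h).1
        exact ⟨this.1, this.2, trivial⟩
      · exact hN.arr_sort x y d h
    · rintro (_ | x) h
      · exact h.elim
      · exact hN.eqv_refl x h
    · rintro (_ | x) (_ | y) h
      iterate 3 exact h.elim
      exact hN.eqv_symm x y h
    · rintro (_ | x) (_ | y) (_ | z) h h'
      iterate 6 exact h.elim
      · exact h'.elim
      · exact hN.eqv_trans x y z h h'
    · rintro (_ | x) (_ | y) (_ | d) h
      iterate 6 exact h.elim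
      · exact (hS x y h).1
      · exact hN.arr_eqv x y d h
    · rintro (_ | x) (_ | y) (_ | d) h h'
      iterate 6 exact h.elim
      · exact (hS x y h).2 h'
      · exact hN.arr_asymm x y d h h'
  · exact ⟨fun _ _ => Option.some_inj, fun _ => Iff.rfl, fun _ => Iff.rfl, fun _ => Iff.rfl,
      fun _ _ => Iff.rfl, fun _ _ _ => Iff.rfl⟩

end Building

/-! ### An explicit generic structure on the natural numbers -/

section GenericModel

/-- A description of an element: its class and whether it lies in `P` if it is an object, together
with finitely many instances of `R` relating it (coded by `none`) to earlier elements. -/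
abbrev Datum : Type := Option (ℕ × Bool) × Finset (Option ℕ × Option ℕ × Option ℕ)

/-- Repeating each description cofinally allows it to be realised beyond any finite set of elements.
-/
theorem exists_datum_enumeration : ∃ f : ℕ → Datum, ∀ D n, ∃ m, n < m ∧ f m = D := by
  obtain ⟨f, hf⟩ := exists_surjective_nat Datum
  refine ⟨fun m => f m.unpair.1, fun D n => ?_⟩
  obtain ⟨k, rfl⟩ := hf D
  exact ⟨Nat.pair k (n + 1), Nat.lt_of_succ_le (Nat.right_le_pair _ _), by simp⟩

/-- An enumeration of all descriptions, each occurring infinitely often. -/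
noncomputable def datum : ℕ → Datum := exists_datum_enumeration.choose

theorem exists_datum_eq (D : Datum) (n : ℕ) : ∃ m, n < m ∧ datum m = D :=
  exists_datum_enumeration.choose_spec D n

/-- The universe of the explicit generic structure. -/
abbrev Gen : Type := ℕ

/-- Code of `x` relative to `m`. -/
def code (m x : ℕ) : Option ℕ := if x = m then none else some x

/-- The sort and class part of the equivalence relation of `Gen`. -/
def GenEqv (x y : ℕ) : Prop :=
  ∃ c b b', (datum x).1 = some (c, b) ∧ (datum y).1 = some (c, b')

/-- The raw instances of `R` listed by the latest of the three elements. -/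
def GenRaw (x y d : ℕ) : Prop :=
  (code (max x (max y d)) x, code (max x (max y d)) y, code (max x (max y d)) d) ∈
    (datum (max x (max y d))).2

/-- Instances of `R` are read off the latest of the three elements; the remaining conjuncts discard
illegal entries, so the axioms hold whatever the data are. -/
noncomputable instance : LOD.Structure Gen :=
  structureOf (X := ℕ) (fun x => ∃ c, (datum x).1 = some c) (fun x => (datum x).1 = none)
    (fun x => ∃ c, (datum x).1 = some (c, true)) GenEqv
    (fun x y d => GenEqv x y ∧ (datum d).1 = none ∧ GenRaw x y d ∧ ¬ GenRaw y x d)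

theorem satisfiesAxioms_gen : SatisfiesAxioms Gen where
  dig_iff x := by
    change (datum x).1 = none ↔ ¬ ∃ c, (datum x).1 = some c
    rw [← Option.isSome_iff_exists]
    simp
  eqv_sort := by
    rintro x y ⟨c, b, b', h, h'⟩
    exact ⟨⟨_, h⟩, ⟨_, h'⟩⟩
  prd_sort := by
    rintro x ⟨c, h⟩
    exact ⟨_, h⟩
  arr_sort := by
    rintro x y d ⟨⟨c, b, b', h, h'⟩, hd, -⟩
    exact ⟨⟨_, h⟩, ⟨_, h'⟩, hd⟩
  eqv_refl := by
    rintro x ⟨⟨c, b⟩, h⟩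
    exact ⟨c, b, b, h, h⟩
  eqv_symm := by
    rintro x y ⟨c, b, b', h, h'⟩
    exact ⟨c, b', b, h', h⟩
  eqv_trans := by
    rintro x y z ⟨c, b, b', h, h'⟩ ⟨c₁, b₁, b₁', h₁, h₁'⟩
    obtain ⟨rfl, rfl⟩ := Prod.ext_iff.1 (Option.some_inj.1 (h'.symm.trans h₁))
    exact ⟨_, b, b₁', h, h₁'⟩
  arr_eqv := fun x y d h => h.1
  arr_asymm := fun x y d h h' => h.2.2.2 h'.2.2.1

theorem code_self (m : ℕ) : code m m = none := if_pos rfl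

theorem code_of_lt {m x : ℕ} (h : x < m) : code m x = some x := if_neg h.ne

/-- If `s` is equivalent to a listed point it inherits that class label; otherwise a label unused by
the finite tuple serves as a new class. -/
theorem exists_datum_of_sort {S β : Type*} [LOD.Structure S] [Finite β] (hS : SatisfiesAxioms S)
    {w : β → Gen} {v : β → S} (h : AtomEq w v) (s : S) :
    ∃ o : Option (ℕ × Bool), (Obj s ↔ ∃ c, o = some c) ∧ (Prd s ↔ ∃ c, o = some (c, true)) ∧
      ∀ i, Eqv s (v i) ↔ ∃ c b b', o = some (c, b) ∧ (datum (w i)).1 = some (c, b') := by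
  classical
  by_cases ho : Obj s
  swap
  · refine ⟨none, iff_of_false ho (by simp), iff_of_false (fun h => ho (hS.prd_sort _ h)) (by simp),
      fun i => iff_of_false (fun h => ho (hS.eqv_sort _ _ h).1) (by simp)⟩
  obtain ⟨c, hc⟩ : ∃ c : ℕ, ∀ i, Eqv s (v i) ↔ ∃ b', (datum (w i)).1 = some (c, b') := by
    by_cases he : ∃ i, Eqv s (v i)
    · obtain ⟨i, hi⟩ := he
      obtain ⟨⟨c, b⟩, hcb⟩ := (h.obj i).2 (hS.eqv_sort _ _ hi).2
      refine ⟨c, fun j => ?_⟩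
      have h1 : Eqv s (v j) ↔ Eqv (w i) (w j) := by
        rw [h.eqv]
        exact ⟨hS.eqv_trans _ _ _ (hS.eqv_symm _ _ hi), hS.eqv_trans _ _ _ hi⟩
      rw [h1]
      constructor
      · rintro ⟨c', b₁, b₂, h₁, h₂⟩
        obtain ⟨rfl, rfl⟩ := Prod.ext_iff.1 (Option.some_inj.1 (hcb.symm.trans h₁))
        exact ⟨b₂, h₂⟩
      · rintro ⟨b', hb'⟩
        exact ⟨c, b, b', hcb, hb'⟩
    · cases nonempty_fintype β
      -- Points of `D` contribute the default label 0, which merely excludes one more value.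
      obtain ⟨c, hc⟩ := Infinite.exists_notMem_finset
        (Finset.univ.image fun i => ((datum (w i)).1.map Prod.fst).getD 0)
      refine ⟨c, fun i => iff_of_false (fun h => he ⟨i, h⟩) ?_⟩
      rintro ⟨b, hb⟩
      exact hc (Finset.mem_image.2 ⟨i, Finset.mem_univ _, by simp [hb]⟩)
  refine ⟨some (c, decide (Prd s)), iff_of_true ho ⟨_, rfl⟩, by simp, fun i => ?_⟩
  rw [hc]
  constructor
  · rintro ⟨b', hb'⟩
    exact ⟨c, _, b', rfl, hb'⟩
  · rintro ⟨c', b, b', h, hb'⟩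
    obtain ⟨rfl, -⟩ := Prod.ext_iff.1 (Option.some_inj.1 h)
    exact ⟨b', hb'⟩

/-- Finite tuples in the explicit generic structure extend in every way compatible with the
axioms. -/
theorem exists_extension_gen {S β : Type*} [LOD.Structure S] [Finite β] (hS : SatisfiesAxioms S)
    {w : β → Gen} {v : β → S} (h : AtomEq w v) (s : S) :
    ∃ y : Gen, AtomEq (Sum.elim w fun _ : Fin 1 => y) (Sum.elim v fun _ : Fin 1 => s) := by
  by_cases hs : ∃ i, v i = s
  · obtain ⟨i, rfl⟩ := hs
    exact ⟨w i, h.elim_of_eq i⟩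
  obtain ⟨o, hobj, hprd, heqv⟩ := exists_datum_of_sort hS h s
  set V : β ⊕ Fin 1 → S := Sum.elim v fun _ => s with hV
  let cd : β ⊕ Fin 1 → Option ℕ := Sum.elim (fun i => some (w i)) fun _ => none
  have hcd : ∀ {i j}, cd i = cd j → V i = V j := by
    rintro (i | i) (j | j) hij
    · exact (h.eq i j).1 (Option.some_inj.1 hij)
    · cases hij
    · cases hij
    · rfl
  -- All instances of `R` in the extended tuple are recorded; those among old points are never read,
  -- since the new element is not the latest of their three.
  let F : Set (Option ℕ × Option ℕ × Option ℕ) :=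
    {t | ∃ i j k, Arr (V i) (V j) (V k) ∧ t = (cd i, cd j, cd k)}
  have hF : F.Finite := by
    refine (Set.finite_range fun t : (β ⊕ Fin 1) × (β ⊕ Fin 1) × (β ⊕ Fin 1) =>
      (cd t.1, cd t.2.1, cd t.2.2)).subset ?_
    rintro _ ⟨i, j, k, -, rfl⟩
    exact ⟨(i, j, k), rfl⟩
  cases nonempty_fintype β
  -- Exceeding every `w i` makes `y` new, and every instance of `R` involving `y` and the tuple is
  -- read from its own datum.
  obtain ⟨y, hy, hD⟩ := exists_datum_eq (o, hF.toFinset) (Finset.univ.sup w)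
  have hlt : ∀ i, w i < y := fun i => (Finset.le_sup (f := w) (Finset.mem_univ i)).trans_lt hy
  have h1 : (datum y).1 = o := by rw [hD]
  have h2 : (datum y).2 = hF.toFinset := by rw [hD]
  set W : β ⊕ Fin 1 → ℕ := Sum.elim w fun _ => y with hW
  have hle : ∀ i, W i ≤ y := by
    rintro (i | i)
    · exact (hlt i).le
    · exact le_rfl
  have hcode : ∀ i, code y (W i) = cd i := by
    rintro (i | i)
    · exact code_of_lt (hlt i)
    · exact code_self y
  have hraw : ∀ i j k, max (W i) (max (W j) (W k)) = y →
      (GenRaw (W i) (W j) (W k) ↔ Arr (V i) (V j) (V k)) := by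
    intro i j k hm
    rw [GenRaw, hm, hcode, hcode, hcode, h2, Set.Finite.mem_toFinset]
    constructor
    · rintro ⟨i', j', k', h', heq⟩
      simp only [Prod.mk.injEq] at heq
      rwa [hcd heq.1, hcd heq.2.1, hcd heq.2.2]
    · exact fun h' => ⟨i, j, k, h', rfl⟩
  have hyobj : Obj (y : Gen) ↔ Obj s := by
    rw [hobj, ← h1]; rfl
  have hyeqv : ∀ i, GenEqv y (w i) ↔ Eqv s (v i) := by
    intro i
    rw [heqv, ← h1]; rfl
  have hyw : ∀ i, (y : Gen) ≠ w i := fun i hi => (hlt i).ne hi.symm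
  have hsv : ∀ i, s ≠ v i := fun i hi => hs ⟨i, hi.symm⟩
  have hgen := satisfiesAxioms_gen
  refine ⟨y, ?_⟩
  -- The conjuncts discarding illegal entries are automatic here, because `S` satisfies the axioms.
  have harr : ∀ i j k, max (W i) (max (W j) (W k)) = y →
      (GenEqv (W i) (W j) ↔ Eqv (V i) (V j)) → (Dig (N := Gen) (W k) ↔ Dig (V k)) →
      (Arr (N := Gen) (W i) (W j) (W k) ↔ Arr (V i) (V j) (V k)) := by
    intro i j k hm he hd
    have hm' : max (W j) (max (W i) (W k)) = y := by
      rw [← hm]; exact max_left_comm _ _ _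
    change GenEqv (W i) (W j) ∧ Dig (N := Gen) (W k) ∧ GenRaw (W i) (W j) (W k) ∧
      ¬ GenRaw (W j) (W i) (W k) ↔ _
    rw [hraw i j k hm, hraw j i k hm', he, hd]
    exact ⟨fun h => h.2.2.1, fun h => ⟨hS.arr_eqv _ _ _ h, (hS.arr_sort _ _ _ h).2.2, h,
      hS.arr_asymm _ _ _ h⟩⟩
  by_cases ho : Obj s
  · refine AtomEq.elim_obj hgen hS h (hyobj.2 ho) ho ?_ hyw hsv hyeqv ?_ ?_
    · rw [hprd, ← h1]; rfl
    · intro i k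
      refine harr (Sum.inr 0) (Sum.inl i) (Sum.inl k) ?_ (hyeqv i) (h.dig k)
      exact max_eq_left (max_le (hle _) (hle _))
    · intro i k
      refine harr (Sum.inl i) (Sum.inr 0) (Sum.inl k) ?_ ?_ (h.dig k)
      · change max (w i) (max y (w k)) = y
        rw [max_eq_left (hlt k).le, max_eq_right (hlt i).le]
      · exact (hgen.eqv_comm (x := w i) (y := y)).trans ((hyeqv i).trans hS.eqv_comm)
  · have hdy : Dig (y : Gen) := (hgen.dig_iff y).2 (fun h => ho (hyobj.1 h))
    have hds : Dig s := (hS.dig_iff s).2 ho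
    refine AtomEq.elim_dig hgen hS h hdy hds hyw hsv fun i j => ?_
    refine harr (Sum.inl i) (Sum.inl j) (Sum.inr 0) ?_ (h.eqv i j) (iff_of_true hdy hds)
    change max (w i) (max (w j) y) = y
    rw [max_eq_right (hlt j).le, max_eq_right (hlt i).le]

/-- Every finite part of a structure satisfying the axioms is found in the generic structure. -/
theorem exists_atomEq_gen {S : Type*} [LOD.Structure S] (hS : SatisfiesAxioms S) (F : Finset S) :
    ∃ g : S → Gen, AtomEq (fun x : F => g x) ((↑) : F → S) := by
  classical
  induction F using Finset.induction_on with
  | empty =>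
    have : IsEmpty (∅ : Finset S) := ⟨fun x => absurd x.2 (Finset.notMem_empty _)⟩
    exact ⟨fun _ => Classical.arbitrary Gen, AtomEq.of_isEmpty _ _⟩
  | insert s F hs ih =>
    obtain ⟨g, hg⟩ := ih
    obtain ⟨y, hy⟩ := exists_extension_gen hS hg s
    refine ⟨Function.update g s y, ?_⟩
    let k : ↥(insert s F) → F ⊕ Fin 1 := fun x =>
      if hx : (x : S) ∈ F then Sum.inl ⟨x, hx⟩ else Sum.inr 0
    have h1 : (fun x : ↥(insert s F) => Function.update g s y x) =
        Sum.elim (fun x : F => g x) (fun _ : Fin 1 => y) ∘ k := by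
      funext x
      by_cases hx : (x : S) ∈ F
      · have : (x : S) ≠ s := fun h => hs (h ▸ hx)
        simp [k, hx, this]
      · have : (x : S) = s := (Finset.mem_insert.1 x.2).resolve_right hx
        simp [k, hs, this]
    have h2 : ((↑) : ↥(insert s F) → S) =
        Sum.elim ((↑) : F → S) (fun _ : Fin 1 => s) ∘ k := by
      funext x
      by_cases hx : (x : S) ∈ F
      · simp [k, hx]
      · have : (x : S) = s := (Finset.mem_insert.1 x.2).resolve_right hx
        simp [k, hs, this]
    rw [h1, h2]
    exact hy.comp k

end GenericModel

/-! ### `Gen` is the Fraïssé limit -/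

section Fraisse

instance : LOD.IsRelational := fun _ => inferInstanceAs (IsEmpty Empty)

variable {N₁ N₂ : Type*} [LOD.Structure N₁] [LOD.Structure N₂]

theorem AtomEq.of_embedding (f : N₁ ↪[LOD] N₂) : AtomEq f (id : N₁ → N₁) where
  eq _ _ := f.injective.eq_iff
  obj x := by
    have := f.map_rel Rel.obj ![x]
    rwa [comp_fin_one] at this
  dig x := by
    have := f.map_rel Rel.dig ![x]
    rwa [comp_fin_one] at this
  prd x := by
    have := f.map_rel Rel.prd ![x]
    rwa [comp_fin_one] at this
  eqv x y := by
    have := f.map_rel Rel.eqv ![x, y]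
    rwa [comp_fin_two] at this
  arr x y d := by
    have := f.map_rel Rel.arr ![x, y, d]
    rwa [comp_fin_three] at this

/-- A map preserving atomic types as an embedding. -/
def AtomEq.toEmbedding {f : N₁ → N₂} (h : AtomEq f (id : N₁ → N₁)) : N₁ ↪[LOD] N₂ where
  toFun := f
  inj' x y hxy := (h.eq x y).1 hxy
  map_fun' f := nomatch f
  map_rel' R t := h.relMap R t

theorem age_gen : LOD.age Gen = finiteClass := by
  ext S
  constructor
  · rintro ⟨hS, ⟨f⟩⟩
    exact ⟨Structure.fg_iff_finite.1 hS,
      satisfiesAxioms_gen.of_atomEq (AtomEq.of_embedding f)⟩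
  · rintro ⟨hS, hS'⟩
    refine ⟨Structure.fg_iff_finite.2 hS, ?_⟩
    cases nonempty_fintype S
    obtain ⟨g, hg⟩ := exists_atomEq_gen hS' (Finset.univ : Finset S)
    exact ⟨AtomEq.toEmbedding (f := g)
      (hg.comp fun x => (⟨x, Finset.mem_univ x⟩ : (Finset.univ : Finset S)))⟩

/-- For a countable structure it suffices to extend an embedding of a finitely generated
substructure by one point, which is `exists_extension_gen` with `Gen` itself as `S`. -/
theorem isUltrahomogeneous_gen : LOD.IsUltrahomogeneous Gen := by
  classical
  rw [isUltrahomogeneous_iff_IsExtensionPair Structure.cg_of_countable,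
    isExtensionPair_iff_exists_embedding_closure_singleton_sup]
  intro S hS f m
  have : Finite S := Substructure.fg_iff_finite.1 hS
  have hfS : AtomEq f ((↑) : S → Gen) :=
    (AtomEq.of_embedding f).trans (AtomEq.of_embedding S.subtype).symm
  obtain ⟨y, hy⟩ := exists_extension_gen satisfiesAxioms_gen hfS m
  -- Without function symbols, adjoining `m` to `S` generates nothing further.
  have hmem : ∀ x : (Substructure.closure LOD {m} ⊔ S : LOD.Substructure Gen),
      (x : Gen) ∉ S → (x : Gen) = m := by
    intro x hx
    have h1 : (Substructure.closure LOD {m} ⊔ S : LOD.Substructure Gen) =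
        Substructure.closure LOD ({m} ∪ S) := by
      rw [Substructure.closure_union, Substructure.closure_eq]
    have h2 : (x : Gen) ∈ Substructure.closure LOD ({m} ∪ (S : Set Gen)) := h1 ▸ x.2
    rw [Substructure.mem_closure_iff_of_isRelational] at h2
    exact h2.resolve_right hx
  let k : (Substructure.closure LOD {m} ⊔ S : LOD.Substructure Gen) → S ⊕ Fin 1 := fun x =>
    if hx : (x : Gen) ∈ S then Sum.inl ⟨x, hx⟩ else Sum.inr 0
  have h2 : Sum.elim ((↑) : S → Gen) (fun _ : Fin 1 => m) ∘ k = (↑) := by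
    funext x
    by_cases hx : (x : Gen) ∈ S
    · simp [k, hx]
    · have hm : m ∉ S := hmem x hx ▸ hx
      simp [k, hm, hmem x hx]
  have h3 := hy.comp k
  rw [h2] at h3
  refine ⟨AtomEq.toEmbedding (h3.trans (AtomEq.of_embedding (Substructure.subtype _))), ?_⟩
  ext x
  have hx : ((Substructure.inclusion (le_sup_right :
      S ≤ Substructure.closure LOD {m} ⊔ S) x : _) : Gen) ∈ S := x.2
  change f x = Sum.elim f (fun _ : Fin 1 => y) (k _)
  simp only [k]
  rw [dif_pos hx]
  rfl

theorem isFraisseLimit_gen : IsFraisseLimit finiteClass Gen :=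
  ⟨isUltrahomogeneous_gen, age_gen⟩

theorem completeTheory_eq_gen {M : Type} [LOD.Structure M] [Countable M]
    (hM : IsFraisseLimit finiteClass M) : LOD.completeTheory M = LOD.completeTheory Gen := by
  obtain ⟨e⟩ := hM.nonempty_equiv isFraisseLimit_gen
  exact e.toElementaryEmbedding.elementarilyEquivalent.completeTheory_eq

end Fraisse

/-! ### Transfer to all models and quantifier elimination -/

section Transfer

variable {α β S N N₁ N₂ : Type*} [LOD.Structure S] [LOD.Structure N] [LOD.Structure N₁]
  [LOD.Structure N₂]

open Classical in
/-- The formula `φ` or its negation, according to the truth value of `p`. -/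
noncomputable def literal (p : Prop) (φ : LOD.Formula α) : LOD.Formula α := if p then φ else ∼φ

theorem realize_literal {p : Prop} {φ : LOD.Formula α} {v : α → N} :
    (literal p φ).Realize v ↔ (φ.Realize v ↔ p) := by
  by_cases hp : p <;> simp [literal, hp]

/-- The formula defining the atomic type of a finite tuple. -/
noncomputable def diagram [Finite β] (v : β → S) : LOD.Formula β :=
  Formula.iInf (fun t : β × β =>
      literal (v t.1 = v t.2) (Term.equal (Term.var t.1) (Term.var t.2))) ⊓
    (Formula.iInf (fun i => literal (Obj (v i)) (objF (Term.var i))) ⊓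
    (Formula.iInf (fun i => literal (Dig (v i)) (digF (Term.var i))) ⊓
    (Formula.iInf (fun i => literal (Prd (v i)) (prdF (Term.var i))) ⊓
    (Formula.iInf (fun t : β × β =>
      literal (Eqv (v t.1) (v t.2)) (eqvF (Term.var t.1) (Term.var t.2))) ⊓
    Formula.iInf (fun t : β × β × β => literal (Arr (v t.1) (v t.2.1) (v t.2.2))
      (arrF (Term.var t.1) (Term.var t.2.1) (Term.var t.2.2)))))))

theorem realize_diagram [Finite β] {v : β → S} {w : β → N} :
    (diagram v).Realize w ↔ AtomEq w v := by
  simp only [diagram, Formula.realize_inf, Formula.realize_iInf, realize_literal,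
    Formula.realize_equal, realize_obj, realize_dig, realize_prd, realize_eqv, realize_arr,
    Term.realize_var, Prod.forall]
  exact ⟨fun ⟨h1, h2, h3, h4, h5, h6⟩ => ⟨h1, h2, h3, h4, h5, h6⟩,
    fun ⟨h1, h2, h3, h4, h5, h6⟩ => ⟨h1, h2, h3, h4, h5, h6⟩⟩

theorem realize_iAlls_relabel [Finite β] (φ : LOD.Formula β) :
    N ⊨ (φ.relabel (Sum.inr : β → Empty ⊕ β)).iAlls β ↔ ∀ w : β → N, φ.Realize w := by
  rw [Sentence.Realize, Formula.realize_iAlls]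
  simp only [Formula.realize_relabel]
  rfl

/-- Regrouping of a tuple whose last entry is singled out. -/
def snocIndex (α : Type*) (n : ℕ) : α ⊕ Fin (n + 1) → (α ⊕ Fin n) ⊕ Fin 1 :=
  Sum.elim (Sum.inl ∘ Sum.inl)
    (Fin.snoc (α := fun _ => (α ⊕ Fin n) ⊕ Fin 1) (Sum.inl ∘ Sum.inr) (Sum.inr 0))

theorem elim_comp_snocIndex {n : ℕ} (f : α → β) (xs : Fin n → β) (a : β) :
    Sum.elim (Sum.elim f xs) (fun _ : Fin 1 => a) ∘ snocIndex α n =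
      Sum.elim f (Fin.snoc xs a) := by
  funext i
  rcases i with i | i
  · rfl
  · refine Fin.lastCases ?_ (fun i => ?_) i <;> simp [snocIndex]

/-- The complete theory of the generic structure. -/
abbrev genTheory : LOD.Theory := LOD.completeTheory Gen

variable [N ⊨ genTheory] [N₁ ⊨ genTheory] [N₂ ⊨ genTheory]

theorem forall_realize_iff_gen [Finite β] (φ : LOD.Formula β) :
    (∀ w : β → N, φ.Realize w) ↔ ∀ w : β → Gen, φ.Realize w := by
  rw [← realize_iAlls_relabel, ← realize_iAlls_relabel]
  exact realize_iff_of_model_completeTheory Gen N _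

-- The atomic type of a triple is expressed by one formula; were it omitted in `Gen`, the negation
-- would transfer to `N`.
variable (N) in
theorem satisfiesAxioms_of_model : SatisfiesAxioms N := by
  refine satisfiesAxioms_gen.of_forall_atomEq fun x => ?_
  by_contra! h
  have h1 : ∀ w : Fin 3 → Gen, Formula.Realize (∼(diagram x)) w := fun w hw =>
    h w (realize_diagram.1 hw).symm
  exact (forall_realize_iff_gen (N := N) _).2 h1 x (realize_diagram.2 (AtomEq.refl x))

/-- Finite tuples in a model of the generic theory extend in every way compatible with the
axioms. -/
theorem exists_extension [Finite β] (hS : SatisfiesAxioms S) {w : β → N} {v : β → S}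
    (h : AtomEq w v) (s : S) :
    ∃ y : N, AtomEq (Sum.elim w fun _ : Fin 1 => y) (Sum.elim v fun _ : Fin 1 => s) := by
  -- The extension property is expressed by a formula in `w`, hence transfers from `Gen`.
  have key : ∀ {M : Type _} [LOD.Structure M] (w : β → M),
      ((diagram v).imp ((diagram (Sum.elim v fun _ : Fin 1 => s)).iExs (Fin 1))).Realize w ↔
        (AtomEq w v →
          ∃ y : M, AtomEq (Sum.elim w fun _ : Fin 1 => y) (Sum.elim v fun _ : Fin 1 => s)) := by
    intro M _ w
    rw [Formula.realize_imp, realize_diagram, Formula.realize_iExs]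
    simp only [realize_diagram]
    refine imp_congr_right fun _ => ⟨fun ⟨y, hy⟩ => ⟨y 0, ?_⟩, fun ⟨y, hy⟩ => ⟨_, hy⟩⟩
    convert hy using 2
    funext i
    rw [Subsingleton.elim i 0]
  have key' : ∀ (w : β → Gen),
      ((diagram v).imp ((diagram (Sum.elim v fun _ : Fin 1 => s)).iExs (Fin 1))).Realize w := by
    intro w
    rw [Formula.realize_imp, realize_diagram, Formula.realize_iExs]
    intro hw
    obtain ⟨y, hy⟩ := exists_extension_gen hS hw s
    exact ⟨_, realize_diagram.2 hy⟩
  exact (key w).1 ((forall_realize_iff_gen _).2 key' w) h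

/-- Back-and-forth: in the quantifier case one-point extension matches a witness on either side,
which is where finiteness of `α` enters. -/
theorem realize_boundedFormula_iff [Finite α] {n : ℕ} (φ : LOD.BoundedFormula α n)
    {f : α → N₁} {g : α → N₂} {xs : Fin n → N₁} {ys : Fin n → N₂}
    (h : AtomEq (Sum.elim f xs) (Sum.elim g ys)) : φ.Realize f xs ↔ φ.Realize g ys := by
  have term : ∀ {m : ℕ} (t : LOD.Term (α ⊕ Fin m)), ∃ i, t = Term.var i := by
    rintro m (i | ⟨⟨⟩, _⟩)
    exact ⟨i, rfl⟩
  induction φ with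
  | falsum => rfl
  | equal t₁ t₂ =>
    obtain ⟨i, rfl⟩ := term t₁
    obtain ⟨j, rfl⟩ := term t₂
    exact h.eq i j
  | rel R ts =>
    choose t ht using fun i => term (ts i)
    obtain rfl : ts = fun i => Term.var (t i) := funext ht
    exact h.relMap R t
  | imp φ ψ ihφ ihψ => exact imp_congr (ihφ h) (ihψ h)
  | @all n φ ih =>
    constructor
    · intro hφ b
      obtain ⟨a, ha⟩ := exists_extension (satisfiesAxioms_of_model N₂) h b
      have := ha.comp (snocIndex α n)
      rw [elim_comp_snocIndex, elim_comp_snocIndex] at this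
      exact (ih this).1 (hφ a)
    · intro hφ a
      obtain ⟨b, hb⟩ := exists_extension (satisfiesAxioms_of_model N₁) h.symm a
      have := hb.symm.comp (snocIndex α n)
      rw [elim_comp_snocIndex, elim_comp_snocIndex] at this
      exact (ih this).2 (hφ b)

/-- Quantifier elimination: in models of the generic theory, tuples of the same atomic type satisfy
the same formulas. -/
theorem AtomEq.realize_iff {f : α → N₁} {g : α → N₂} (h : AtomEq f g) (φ : LOD.Formula α) :
    φ.Realize f ↔ φ.Realize g := by
  classical
  -- Restricting to the free variables of `φ` makes the tuple finite.
  have h1 := realize_boundedFormula_iff (φ.restrictFreeVar id)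
    (f := fun i : φ.freeVarFinset => f i) (g := fun i : φ.freeVarFinset => g i)
    (xs := default) (ys := default) (by
      have h2 := h.comp (Sum.elim ((↑) : φ.freeVarFinset → α) (fun i : Fin 0 => i.elim0))
      convert h2 using 1 <;>
      · funext i
        rcases i with i | i
        · rfl
        · exact i.elim0)
  rw [BoundedFormula.realize_restrictFreeVar f (by simp),
    BoundedFormula.realize_restrictFreeVar g (by simp)] at h1
  exact h1

theorem AtomEq.sat_iff {A : Type*} {c₁ : A → N₁} {c₂ : A → N₂} {x₁ : α → N₁} {x₂ : α → N₂}
    (h : AtomEq (Sum.elim c₁ x₁) (Sum.elim c₂ x₂)) (φ : LOD[[A]].Formula α) :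
    Sat c₁ x₁ φ ↔ Sat c₂ x₂ φ := by
  rw [sat_iff_constantsVarsEquiv, sat_iff_constantsVarsEquiv]
  exact h.realize_iff _

end Transfer

/-! ### Embedding structures that satisfy the axioms into models -/

section Ultrapower

/-- Compactness through an ultrapower of `Gen`: `g F` copies the finite part `F` of `S` faithfully,
and `s` is sent to the class of `F ↦ g F s`. The ultrafilter contains every cone `{G | F ⊆ G}`, so
each atomic fact is eventually computed correctly. -/
theorem exists_model_extending {S : Type u} [LOD.Structure S] (hS : SatisfiesAxioms S) :
    ∃ (N : Type u) (_ : LOD.Structure N) (_ : Nonempty N) (_ : N ⊨ genTheory) (f : S → N),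
      AtomEq f (id : S → S) := by
  classical
  choose g hg using exists_atomEq_gen hS
  let u : Ultrafilter (Finset S) := Ultrafilter.of Filter.atTop
  have hu : ∀ F : Finset S, ∀ᶠ G in (u : Filter (Finset S)), F ⊆ G := fun F =>
    Ultrafilter.of_le (Filter.atTop) (Filter.eventually_ge_atTop F)
  let f : S → (u : Filter (Finset S)).Product (fun _ => Gen) := fun s =>
    ((fun F => g F s : Finset S → Gen) : (u : Filter (Finset S)).Product fun _ => Gen)
  have key : ∀ (φ : LOD.Formula S) (F : Finset S) (p : Prop),
      (∀ G, F ⊆ G → (φ.Realize (g G) ↔ p)) → (φ.Realize f ↔ p) := by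
    intro φ F p h
    refine (Ultraproduct.realize_formula_cast φ fun s G => g G s).trans ?_
    rw [Filter.eventually_congr ((hu F).mono h), Filter.eventually_const]
  refine ⟨_, inferInstance, inferInstance, ⟨fun φ hφ => ?_⟩, f, ?_⟩
  · exact (Ultraproduct.sentence_realize φ).2 (Filter.Eventually.of_forall fun _ => hφ)
  · constructor
    · intro i j
      have := key (Term.equal (Term.var i) (Term.var j)) {i, j} (i = j) fun G hG => by
        rw [Formula.realize_equal]
        exact (hg G).eq ⟨i, hG (by simp)⟩ ⟨j, hG (by simp)⟩ |>.trans (by simp)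
      rwa [Formula.realize_equal] at this
    · intro i
      refine realize_obj.symm.trans (key (objF (Term.var i)) {i} (Obj i) fun G hG => ?_)
      exact realize_obj.trans ((hg G).obj ⟨i, hG (by simp)⟩)
    · intro i
      refine realize_dig.symm.trans (key (digF (Term.var i)) {i} (Dig i) fun G hG => ?_)
      exact realize_dig.trans ((hg G).dig ⟨i, hG (by simp)⟩)
    · intro i
      refine realize_prd.symm.trans (key (prdF (Term.var i)) {i} (Prd i) fun G hG => ?_)
      exact realize_prd.trans ((hg G).prd ⟨i, hG (by simp)⟩)
    · intro i j
      refine realize_eqv.symm.trans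
        (key (eqvF (Term.var i) (Term.var j)) {i, j} (Eqv i j) fun G hG => ?_)
      exact realize_eqv.trans ((hg G).eqv ⟨i, hG (by simp)⟩ ⟨j, hG (by simp)⟩)
    · intro i j k
      refine realize_arr.symm.trans
        (key (arrF (Term.var i) (Term.var j) (Term.var k)) {i, j, k} (Arr i j k) fun G hG => ?_)
      exact realize_arr.trans
        ((hg G).arr ⟨i, hG (by simp)⟩ ⟨j, hG (by simp)⟩ ⟨k, hG (by simp)⟩)

end Ultrapower

/-! ### Genericity of every model -/

section Generic

variable {N : Type*} [LOD.Structure N] [N ⊨ genTheory]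

/-- The point is first adjoined abstractly, in the class `K` or in a new one if `K` is empty; its
atomic type over the finite set `F ∪ W ∪ G` is then realised inside `N`. -/
theorem exists_obj_of_finite {F W : Finset N} {K : N → Prop} (hK : ∀ x y, K x → (K y ↔ Eqv x y))
    (hF : ∀ y ∈ F, K y) (hW : ∀ d ∈ W, Dig d) (G : Finset N)
    (inP : Prop) {out inn : N → N → Prop} (hdisj : ∀ y d, ¬ (out y d ∧ inn y d)) :
    ∃ x : N, Obj x ∧ (∀ y ∈ G, Eqv x y ↔ K y) ∧ x ∉ F ∧ x ∉ G ∧ (Prd x ↔ inP) ∧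
      ∀ y ∈ F, ∀ d ∈ W, (Arr x y d ↔ out y d) ∧ (Arr y x d ↔ inn y d) := by
  classical
  -- Cutting `out` and `inn` down to `F` and `W` makes the prescription legal.
  obtain ⟨_, hS, hsome, ho, hp, he, hout, hinn⟩ :=
    (satisfiesAxioms_of_model N).exists_new_obj K hK inP
      (fun y d => (y ∈ F ∧ d ∈ W) ∧ out y d) (fun y d => (y ∈ F ∧ d ∈ W) ∧ inn y d)
      (fun y d h => ⟨hF y h.1.1, hW d h.1.2⟩) (fun y d h => ⟨hF y h.1.1, hW d h.1.2⟩)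
      (fun y d h => hdisj y d ⟨h.1.2, h.2.2⟩)
  obtain ⟨x, hx⟩ := exists_extension hS
    (hsome.comp ((↑) : ((F ∪ W ∪ G : Finset N) : Set N) → N)).symm none
  have hne : ∀ y ∈ F ∪ W ∪ G, x ≠ y := fun y hy h => by
    simpa using (hx.eq (Sum.inr 0) (Sum.inl ⟨y, hy⟩)).1 h
  have mF : ∀ {y}, y ∈ F → y ∈ F ∪ W ∪ G := fun h => by simp [h]
  have mW : ∀ {y}, y ∈ W → y ∈ F ∪ W ∪ G := fun h => by simp [h]
  have mG : ∀ {y}, y ∈ G → y ∈ F ∪ W ∪ G := fun h => by simp [h]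
  refine ⟨x, (hx.obj (Sum.inr 0)).2 ho,
    fun y hy => (hx.eqv (Sum.inr 0) (Sum.inl ⟨y, mG hy⟩)).trans (he y),
    fun h => hne x (mF h) rfl, fun h => hne x (mG h) rfl,
    (hx.prd (Sum.inr 0)).trans hp, fun y hy d hd => ⟨?_, ?_⟩⟩
  · refine (hx.arr (Sum.inr 0) (Sum.inl ⟨y, mF hy⟩) (Sum.inl ⟨d, mW hd⟩)).trans
      ((hout y d).trans (and_iff_right ⟨hy, hd⟩))
  · refine (hx.arr (Sum.inl ⟨y, mF hy⟩) (Sum.inr 0) (Sum.inl ⟨d, mW hd⟩)).trans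
      ((hinn y d).trans (and_iff_right ⟨hy, hd⟩))

theorem exists_dig_of_finite {F : Finset N} {S : N → N → Prop}
    (hS : ∀ y ∈ F, ∀ z ∈ F, S y z → Eqv y z ∧ ¬ S z y) (G : Finset N) :
    ∃ d : N, d ∉ G ∧ Dig d ∧ ∀ y ∈ F, ∀ z ∈ F, (Arr y z d ↔ S y z) := by
  classical
  obtain ⟨_, hS, hsome, hd, ha⟩ :=
    (satisfiesAxioms_of_model N).exists_new_dig (fun y z => (y ∈ F ∧ z ∈ F) ∧ S y z)
      (fun y z h => ⟨(hS y h.1.1 z h.1.2 h.2).1, fun h' => (hS y h.1.1 z h.1.2 h.2).2 h'.2⟩)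
  obtain ⟨d, hx⟩ := exists_extension hS
    (hsome.comp ((↑) : ((F ∪ G : Finset N) : Set N) → N)).symm none
  have mF : ∀ {y}, y ∈ F → y ∈ F ∪ G := fun h => by simp [h]
  refine ⟨d, fun h => ?_, (hx.dig (Sum.inr 0)).2 hd, fun y hy z hz => ?_⟩
  · have hG : d ∈ F ∪ G := by simp [h]
    simpa using (hx.eq (Sum.inr 0) (Sum.inl ⟨d, hG⟩)).1 rfl
  · exact (hx.arr (Sum.inl ⟨y, mF hy⟩) (Sum.inl ⟨z, mF hz⟩) (Sum.inr 0)).trans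
      ((ha y z).trans (and_iff_right ⟨hy, hz⟩))

-- For the infinitude clauses, a finite set is refuted by an extension avoiding it.
variable (N) in
theorem isGeneric_of_model : IsGeneric N := by
  classical
  have hN := satisfiesAxioms_of_model N
  have hK : ∀ c x y : N, Eqv c x → (Eqv c y ↔ Eqv x y) := fun c x y h =>
    ⟨hN.eqv_trans _ _ _ (hN.eqv_symm _ _ h), hN.eqv_trans _ _ _ h⟩
  have hclass : ∀ c : N, Obj c → ∀ F W : Finset N, (∀ y ∈ F, Eqv c y) → (∀ d ∈ W, Dig d) →
      ∀ (inP : Prop) (out inn : N → N → Prop), (∀ y d, ¬ (out y d ∧ inn y d)) →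
        ∃ x, Eqv c x ∧ x ∉ F ∧ (Prd x ↔ inP) ∧
          ∀ y ∈ F, ∀ d ∈ W, (Arr x y d ↔ out y d) ∧ (Arr y x d ↔ inn y d) := by
    intro c hc F W hF hW inP out inn hdisj
    obtain ⟨x, -, he, hx, -, hp, ha⟩ :=
      exists_obj_of_finite (hK c) hF hW {c} inP hdisj
    refine ⟨x, hN.eqv_symm _ _ ((he c (by simp)).2 (hN.eqv_refl c hc)), hx, hp, ha⟩
  refine { hN with
    infinite_classes := ?_, infinite_prd := ?_, infinite_not_prd := ?_,
    extend_obj := hclass, extend_dig := ?_ }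
  · intro hfin
    have h1 : {C : Set N | ∃ x, Obj x ∧ C = {y | Eqv x y}} =
        (fun x => {y | Eqv x y}) '' {x : N | Obj x} := by
      ext C
      simp only [Set.mem_image, Set.mem_ofPred_eq, eq_comm]
    rw [h1] at hfin
    -- `t` is a finite set meeting every class; a point inequivalent to all of `t` is a
    -- contradiction.
    obtain ⟨t, ht, ht', h2⟩ := hfin.exists_subset_finite_image_eq subset_rfl
    obtain ⟨x, hx, he, -⟩ := exists_obj_of_finite (N := N) (F := ∅) (W := ∅) (K := fun _ => False)
      (by simp) (by simp) (by simp) ht'.toFinset True (out := fun _ _ => False)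
      (inn := fun _ _ => False) (by simp)
    have : {y | Eqv x y} ∈ (fun x => {y | Eqv x y}) '' {x : N | Obj x} := ⟨x, hx, rfl⟩
    rw [← h2] at this
    obtain ⟨y, hy, hxy⟩ := this
    have hxy' : y ∈ {z | Eqv x z} := by
      rw [← hxy]
      exact hN.eqv_refl y (ht hy)
    exact (he y (by simpa using hy)).1 hxy'
  · intro x hx hfin
    obtain ⟨y, hy, hyF, hp, -⟩ := hclass x hx hfin.toFinset ∅ (fun y hy => by
      simpa using (hfin.mem_toFinset.1 hy).1) (by simp) True (fun _ _ => False)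
      (fun _ _ => False) (by simp)
    exact hyF (hfin.mem_toFinset.2 ⟨hy, hp.2 trivial⟩)
  · intro x hx hfin
    obtain ⟨y, hy, hyF, hp, -⟩ := hclass x hx hfin.toFinset ∅ (fun y hy => by
      simpa using (hfin.mem_toFinset.1 hy).1) (by simp) False (fun _ _ => False)
      (fun _ _ => False) (by simp)
    exact hyF (hfin.mem_toFinset.2 ⟨hy, hp.1⟩)
  · intro F hF S hS hfin
    obtain ⟨d, hd, hdd, ha⟩ := exists_dig_of_finite hS hfin.toFinset
    exact hd (hfin.mem_toFinset.2 ⟨hdd, ha⟩)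

end Generic

/-! ### Elementary maps as maps preserving atomic types -/

section Elementary

variable {A V N : Type*} [LOD.Structure V] [LOD.Structure N]

theorem Elem.models_genTheory [hV : V ⊨ genTheory] {c₀ : A → V} {c : A → N}
    (h : Elem LOD c₀ c) : N ⊨ genTheory :=
  ⟨fun φ hφ => (h.realize_sentence φ).1 (hV.realize_of_mem φ hφ)⟩

theorem Elem.atomEq {c₀ : A → V} {c : A → N} (h : Elem LOD c₀ c) : AtomEq c c₀ :=
  AtomEq.of_realize fun ψ => (h ψ).symm

theorem AtomEq.elem [V ⊨ genTheory] [N ⊨ genTheory] {c₀ : A → V} {c : A → N}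
    (h : AtomEq c c₀) : Elem LOD c₀ c := fun ψ => (h.realize_iff ψ).symm

theorem Elem.comp {B : Type*} {c₀ : A → V} {c : A → N} (h : Elem LOD c₀ c) (k : B → A) :
    Elem LOD (c₀ ∘ k) (c ∘ k) := fun ψ => by
  rw [← Formula.realize_relabel, ← Formula.realize_relabel]
  exact h _

end Elementary

/-! ### Points in a new class -/

section NewClass

variable {A N N₁ N₂ : Type*} [LOD.Structure N] [LOD.Structure N₁] [LOD.Structure N₂]

/-- `x` is an object whose class contains no point of the tuple `c`, and lies in `P` iff `s`. -/
structure IsNew (s : Prop) (c : A → N) (x : N) : Prop where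
  obj : Obj x
  prd : Prd x ↔ s
  not_eqv : ∀ a, ¬ Eqv x (c a)

theorem IsNew.comp {B : Type*} {s : Prop} {c : A → N} {x : N} (h : IsNew s c x) (k : B → A) :
    IsNew s (c ∘ k) x := ⟨h.obj, h.prd, fun b => h.not_eqv (k b)⟩

/-- Newness belongs to the `E`-class, not the point; this drives domination in both directions. -/
theorem IsNew.of_eqv (hN : SatisfiesAxioms N) {s t : Prop} {c : A → N} {x y : N}
    (h : IsNew s c x) (hxy : Eqv x y) (hy : Prd y ↔ t) : IsNew t c y :=
  ⟨(hN.eqv_sort _ _ hxy).2, hy, fun a ha => h.not_eqv a (hN.eqv_trans _ _ _ hxy ha)⟩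

theorem IsNew.ne (hN : SatisfiesAxioms N) {s : Prop} {c : A → N} {x : N} (h : IsNew s c x)
    (a : A) : x ≠ c a := by
  rintro rfl
  exact h.not_eqv a (hN.eqv_refl _ h.obj)

/-- Since `R` lives inside classes, a new point has no instance of `E` or `R` with the tuple, and
only `P` is left to compare. -/
theorem AtomEq.elim_new (h₁ : SatisfiesAxioms N₁) (h₂ : SatisfiesAxioms N₂) {s : Prop}
    {c₁ : A → N₁} {c₂ : A → N₂} (h : AtomEq c₁ c₂) {x : Fin 1 → N₁} {y : Fin 1 → N₂}
    (hx : IsNew s c₁ (x 0)) (hy : IsNew s c₂ (y 0)) :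
    AtomEq (Sum.elim c₁ x) (Sum.elim c₂ y) :=
  AtomEq.elim_obj h₁ h₂ h hx.obj hy.obj (hx.prd.trans hy.prd.symm) (hx.ne h₁) (hy.ne h₂)
    (fun i => iff_of_false (hx.not_eqv i) (hy.not_eqv i))
    (fun i _ => iff_of_false (fun h => hx.not_eqv i (h₁.arr_eqv _ _ _ h))
      fun h => hy.not_eqv i (h₂.arr_eqv _ _ _ h))
    (fun i _ => iff_of_false
      (fun h => hx.not_eqv i (h₁.eqv_symm _ _ (h₁.arr_eqv _ _ _ h)))
      fun h => hy.not_eqv i (h₂.eqv_symm _ _ (h₂.arr_eqv _ _ _ h)))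

end NewClass

/-! ### The global types, their invariance and domination -/

section Types

variable {U : Type u}

section Sat

variable {N : Type*} [LOD.Structure N] {c : U → N}

theorem sat_objFormula {x : Fin 1 → N} : Sat c x (objFormula U) ↔ Obj (x 0) := by
  rw [objFormula, sat_onFormula]
  exact realize_obj

theorem sat_prdFormula {x : Fin 1 → N} : Sat c x (prdFormula U) ↔ Prd (x 0) := by
  rw [prdFormula, sat_onFormula]
  exact realize_prd

theorem sat_notEqvFormula {x : Fin 1 → N} {d : U} :
    Sat c x (notEqvFormula d) ↔ ¬ Eqv (x 0) (c d) := by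
  let : (constantsOn U).Structure N := constantsOn.structure c
  rw [notEqvFormula, sat_not]
  refine not_congr ?_
  refine Formula.realize_rel₂.trans ?_
  rw [realize_con_term]
  rfl

theorem sat_rho {c : (∅ : Set U) → N} {z : Fin 1 ⊕ Fin 1 → N} :
    Sat c z (rho U) ↔ Eqv (z (Sum.inl 0)) (z (Sum.inr 0)) ∧ Prd (z (Sum.inl 0)) ∧
      ¬ Prd (z (Sum.inr 0)) := by
  rw [rho, sat_onFormula, Formula.realize_inf, Formula.realize_inf, Formula.realize_not]
  exact and_congr realize_eqv (and_congr realize_prd (not_congr realize_prd))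

variable [LOD.Structure U]

theorem sat_newClass (hN : SatisfiesAxioms N) (hc : ∀ d, Obj (c d) ↔ Obj d) {x : Fin 1 → N} :
    (∀ ψ ∈ newClass U, Sat c x ψ) ↔ Obj (x 0) ∧ ∀ d, ¬ Eqv (x 0) (c d) := by
  constructor
  · intro h
    refine ⟨sat_objFormula.1 (h _ (Or.inl rfl)), fun d hd => ?_⟩
    have hd' : Obj d := (hc d).1 (hN.eqv_sort _ _ hd).2
    exact sat_notEqvFormula.1 (h _ (Or.inr ⟨d, hd', rfl⟩)) hd
  · rintro ⟨ho, hd⟩ ψ (rfl | ⟨d, -, rfl⟩)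
    · exact sat_objFormula.2 ho
    · exact sat_notEqvFormula.2 (hd d)

theorem sat_newClassPrd (hN : SatisfiesAxioms N) (hc : ∀ d, Obj (c d) ↔ Obj d)
    {x : Fin 1 → N} : (∀ ψ ∈ newClassPrd U, Sat c x ψ) ↔ IsNew True c (x 0) := by
  constructor
  · intro h
    have h1 := (sat_newClass hN hc).1 fun ψ hψ => h ψ (Or.inl hψ)
    exact ⟨h1.1, iff_true_intro (sat_prdFormula.1 (h _ (Or.inr rfl))), h1.2⟩
  · rintro h ψ (hψ | rfl)
    · exact (sat_newClass hN hc).2 ⟨h.obj, h.not_eqv⟩ ψ hψ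
    · exact sat_prdFormula.2 (h.prd.2 trivial)

theorem sat_newClassNotPrd (hN : SatisfiesAxioms N) (hc : ∀ d, Obj (c d) ↔ Obj d)
    {x : Fin 1 → N} : (∀ ψ ∈ newClassNotPrd U, Sat c x ψ) ↔ IsNew False c (x 0) := by
  constructor
  · intro h
    have h1 := (sat_newClass hN hc).1 fun ψ hψ => h ψ (Or.inl hψ)
    exact ⟨h1.1, iff_false_intro fun hp => sat_not c x _ |>.1 (h (∼(prdFormula U)) (Or.inr rfl))
      (sat_prdFormula.2 hp), h1.2⟩
  · rintro h ψ (hψ | rfl)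
    · exact (sat_newClass hN hc).2 ⟨h.obj, h.not_eqv⟩ ψ hψ
    · exact (sat_not c x _).2 fun hp => h.prd.1 (sat_prdFormula.1 hp)

theorem sat_eqvFormula {A : Set U} {c : A → N} {z : Fin 1 ⊕ Fin 1 → N} :
    Sat c z (eqvFormula A) ↔ Eqv (z (Sum.inl 0)) (z (Sum.inr 0)) := by
  rw [eqvFormula, sat_onFormula]
  exact realize_eqv

theorem sat_arrFormula {z : Fin 1 ⊕ Fin 1 → N} {d : U} :
    Sat c z (arrFormula d) ↔ Arr (z (Sum.inl 0)) (z (Sum.inr 0)) (c d) := by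
  let : (constantsOn U).Structure N := constantsOn.structure c
  rw [Sat, arrFormula, Formula.realize_rel, Arr, iff_iff_eq]
  change Structure.RelMap (L := LOD) Rel.arr _ = _
  congr 1
  funext i
  fin_cases i
  · rfl
  · rfl
  · exact realize_con_term c z d

end Sat

variable [LOD.Structure U]

theorem globalEntails_iff {α : Type} {Γ : Set (LOD[[U]].Formula α)} {φ : LOD[[U]].Formula α} :
    Entails (LOD.elementaryDiagram U) Γ φ ↔
      ∀ (N : Type u) [LOD.Structure N] [Nonempty N] (c : U → N), Elem LOD (id : U → U) c →
        ∀ x : α → N, (∀ ψ ∈ Γ, Sat c x ψ) → Sat c x φ :=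
  entails_iff

/-- The global type `p` axiomatises lying in a new class, and in `P` iff `s`. -/
def IsNewType (s : Prop) (p : GlobalType LOD U (Fin 1)) : Prop :=
  ∀ (N : Type u) [LOD.Structure N] (c : U → N), Elem LOD (id : U → U) c →
    ∀ x : Fin 1 → N, (∀ φ ∈ formulas p, Sat c x φ) ↔ IsNew s c (x 0)

theorem IsNewType.mem_iff {s : Prop} {p : GlobalType LOD U (Fin 1)} (hp : IsNewType s p)
    {N : Type u} [LOD.Structure N] {c : U → N} (hc : Elem LOD (id : U → U) c) {x : Fin 1 → N}
    (hx : IsNew s c (x 0)) (φ : LOD[[U]].Formula (Fin 1)) : φ ∈ formulas p ↔ Sat c x φ := by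
  have h := (hp N c hc x).2 hx
  refine ⟨h φ, fun hφ => ?_⟩
  by_contra hn
  exact h _ (mem_formulas_not.2 hn) hφ

variable {p q : GlobalType LOD U (Fin 1)}

theorem sat_of_mem_unionLeft {A : Set U} {r : TypeOver LOD A (Fin 1 ⊕ Fin 1)} {N : Type*}
    [LOD.Structure N] {c : U → N} {z : Fin 1 ⊕ Fin 1 → N} :
    (∀ ψ ∈ unionLeft p r, Sat c z ψ) ↔ (∀ φ ∈ formulas p, Sat c (z ∘ Sum.inl) φ) ∧
      ∀ φ ∈ formulas r, Sat (c ∘ ((↑) : A → U)) z φ := by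
  simp only [unionLeft, Set.mem_union, or_imp, forall_and, Set.forall_mem_image, sat_relabel,
    sat_onFormula_map]

theorem sat_of_mem_unionRight {A : Set U} {r : TypeOver LOD A (Fin 1 ⊕ Fin 1)} {N : Type*}
    [LOD.Structure N] {c : U → N} {z : Fin 1 ⊕ Fin 1 → N} :
    (∀ ψ ∈ unionRight q r, Sat c z ψ) ↔ (∀ φ ∈ formulas q, Sat c (z ∘ Sum.inr) φ) ∧
      ∀ φ ∈ formulas r, Sat (c ∘ ((↑) : A → U)) z φ := by
  simp only [unionRight, Set.mem_union, or_imp, forall_and, Set.forall_mem_image, sat_relabel,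
    sat_onFormula_map]

variable [U ⊨ genTheory]

/-- By quantifier elimination the embedding of `U` is elementary, so elementary extensions can be
produced from structures written down by hand. -/
theorem exists_elem_extending {S : Type u} [LOD.Structure S] (hS : SatisfiesAxioms S)
    {e : U → S} (he : AtomEq e (id : U → U)) :
    ∃ (N : Type u) (_ : LOD.Structure N) (_ : Nonempty N) (_ : N ⊨ genTheory) (f : S → N),
      AtomEq f (id : S → S) ∧ Elem LOD (id : U → U) (f ∘ e) := by
  obtain ⟨N, _, _, hN, f, hf⟩ := exists_model_extending hS
  exact ⟨N, _, ‹_›, hN, f, hf, ((hf.comp e).trans he).elem⟩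

variable (U) in
theorem exists_isNew (s : Prop) :
    ∃ (N : Type u) (_ : LOD.Structure N) (_ : Nonempty N) (_ : N ⊨ genTheory) (c : U → N)
      (x : Fin 1 → N), Elem LOD (id : U → U) c ∧ IsNew s c (x 0) := by
  obtain ⟨_, hS, hsome, ho, hp, he, -⟩ :=
    (satisfiesAxioms_of_model U).exists_new_obj (fun _ => False) (by simp) s (fun _ _ => False)
      (fun _ _ => False) (by simp) (by simp) (by simp)
  obtain ⟨N, _, _, hN, f, hf, hc⟩ := exists_elem_extending hS hsome
  exact ⟨N, _, ‹_›, hN, f ∘ some, fun _ => f none, hc, (hf.obj none).2 ho, (hf.prd none).trans hp,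
    fun a ha => (he a).1 ((hf.eqv none (some a)).1 ha)⟩

/-- By `AtomEq.elim_new` all realisations of `Γ` in elementary extensions share one atomic type over
`U`, hence one complete type. -/
theorem exists_isNewType {s : Prop} {Γ : Set (LOD[[U]].Formula (Fin 1))}
    (hΓ : ∀ (N : Type u) [LOD.Structure N] (c : U → N), SatisfiesAxioms N →
      (∀ d, Obj (c d) ↔ Obj d) → ∀ x : Fin 1 → N,
        (∀ ψ ∈ Γ, Sat c x ψ) ↔ IsNew s c (x 0)) :
    ∃ p : GlobalType LOD U (Fin 1), (∀ p', Γ ⊆ formulas p' ↔ p' = p) ∧ IsNewType s p := by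
  obtain ⟨N, _, _, _, c, x, hc, hx⟩ := exists_isNew U s
  obtain ⟨p, hp⟩ : ∃ p : GlobalType LOD U (Fin 1), formulas p = {φ | Sat c x φ} :=
    exists_completeType hc x
  have hΓ' : ∀ (N : Type u) [LOD.Structure N] (c : U → N), Elem LOD (id : U → U) c →
      ∀ x : Fin 1 → N, (∀ ψ ∈ Γ, Sat c x ψ) ↔ IsNew s c (x 0) := by
    intro N _ c hc x
    have := hc.models_genTheory
    exact hΓ N c (satisfiesAxioms_of_model N) hc.atomEq.obj x
  have hΓp : Γ ⊆ formulas p := fun ψ hψ => by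
    rw [hp]
    exact (hΓ' N c hc x).2 hx ψ hψ
  have huniq : ∀ {N' : Type u} [LOD.Structure N'] {c' : U → N'} {x' : Fin 1 → N'},
      Elem LOD (id : U → U) c' → IsNew s c' (x' 0) → ∀ φ, φ ∈ formulas p ↔ Sat c' x' φ := by
    intro N' _ c' x' hc' hx' φ
    have := hc'.models_genTheory
    rw [hp]
    exact (AtomEq.elim_new (satisfiesAxioms_of_model N) (satisfiesAxioms_of_model N')
      (hc.atomEq.trans hc'.atomEq.symm) hx hx').sat_iff φ
  refine ⟨p, fun p' => ⟨fun h => completeType_ext ?_, ?_⟩, fun N' _ c' hc' x' => ⟨?_, ?_⟩⟩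
  · obtain ⟨N', _, _, c', x', hc', hp'⟩ := exists_formulas_eq_sat p'
    ext φ
    rw [huniq hc' ((hΓ' N' c' hc' x').1 fun ψ hψ => ?_) φ, hp']
    · rfl
    · have := h hψ
      rwa [hp'] at this
  · rintro rfl
    exact hΓp
  · exact fun h => (hΓ' N' c' hc' x').1 fun ψ hψ => h ψ (hΓp hψ)
  · exact fun h φ hφ => (huniq hc' h φ).1 hφ

/-- The atomic type of a new point together with `b` depends only on that of `b`. -/
theorem IsNewType.isInvariantOver {s : Prop} {p : GlobalType LOD U (Fin 1)}
    (hp : IsNewType s p) : IsInvariantOver ∅ p := by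
  intro n φ b b' h
  obtain ⟨N, _, _, _, c, x, hc, hx⟩ := exists_isNew U s
  rw [hp.mem_iff hc hx, hp.mem_iff hc hx, sat_instantiate, sat_instantiate]
  have hb : AtomEq b b' := AtomEq.of_realize fun ψ => by
    have := h ((LOD.lhomWithConstants (∅ : Set U)).onFormula ψ)
    rwa [LHom.realize_onFormula, LHom.realize_onFormula] at this
  have hcb : AtomEq (c ∘ b) (c ∘ b') :=
    (hc.atomEq.comp b).trans (hb.trans (hc.atomEq.comp b').symm)
  have hN := satisfiesAxioms_of_model N
  have h1 := (AtomEq.elim_new hN hN hcb (hx.comp b) (hx.comp b')).comp Sum.swap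
  have h2 : ∀ b : Fin n → U,
      Sum.elim (c ∘ b) x ∘ (Sum.swap : Fin 1 ⊕ Fin n → Fin n ⊕ Fin 1) = Sum.elim x (c ∘ b) := by
    intro b
    funext i
    rcases i with i | i <;> rfl
  rw [h2, h2] at h1
  exact h1.realize_iff φ

/-- A joint type of points of the same new class. -/
theorem exists_isJoint_eqv {s t : Prop} (hp : IsNewType s p) (hq : IsNewType t q) :
    ∃ (N : Type u) (_ : LOD.Structure N) (c : (∅ : Set U) → N) (z : Fin 1 ⊕ Fin 1 → N)
      (r : TypeOver LOD (∅ : Set U) (Fin 1 ⊕ Fin 1)), IsJoint p q r ∧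
        formulas r = {φ | Sat c z φ} ∧ Eqv (z (Sum.inl 0)) (z (Sum.inr 0)) ∧
        (Prd (z (Sum.inl 0)) ↔ s) ∧ (Prd (z (Sum.inr 0)) ↔ t) := by
  obtain ⟨N, _, _, _, c, x, hc, hx⟩ := exists_isNew U s
  have hN := satisfiesAxioms_of_model N
  obtain ⟨y, hxy, -, hyt, -⟩ := (isGeneric_of_model N).extend_obj (x 0) hx.obj ∅ ∅ (by simp)
    (by simp) t (fun _ _ => False) (fun _ _ => False) (by simp)
  have hy : IsNew t c y := hx.of_eqv hN hxy hyt
  obtain ⟨r, hr⟩ : ∃ r : TypeOver LOD (∅ : Set U) (Fin 1 ⊕ Fin 1),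
      formulas r = {φ | Sat (c ∘ ((↑) : (∅ : Set U) → U)) (Sum.elim x fun _ => y) φ} :=
    exists_completeType (hc.comp _) _
  refine ⟨N, _, _, _, r, ⟨fun φ hφ => ?_, fun φ hφ => ?_⟩, hr, hxy, hx.prd, hyt⟩
  · rw [hp.mem_iff hc hx, sat_onFormula_map] at hφ
    rw [hr, Set.mem_ofPred_eq, sat_relabel]
    exact hφ
  · rw [hq.mem_iff (x := fun _ => y) hc hy, sat_onFormula_map] at hφ
    rw [hr, Set.mem_ofPred_eq, sat_relabel]
    exact hφ

theorem exists_isJoint_rho (hp : IsNewType True p) (hq : IsNewType False q) :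
    ∃ r : TypeOver LOD (∅ : Set U) (Fin 1 ⊕ Fin 1), IsJoint p q r ∧ rho U ∈ formulas r := by
  obtain ⟨N, _, c, z, r, hr, hrz, he, hs, ht⟩ := exists_isJoint_eqv hp hq
  refine ⟨r, hr, ?_⟩
  rw [hrz]
  exact sat_rho.2 ⟨he, hs.2 trivial, ht.1⟩

/-- The class of `x` misses `U`, hence so does that of `y`, and the status of `y` in `P` settles its
type. -/
theorem entailsRight_of_eqv {s t : Prop} (hp : IsNewType s p) (hq : IsNewType t q) {A : Set U}
    {r : TypeOver LOD A (Fin 1 ⊕ Fin 1)}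
    (h : ∀ (N : Type u) [LOD.Structure N] (c : A → N) (z : Fin 1 ⊕ Fin 1 → N),
      (∀ φ ∈ formulas r, Sat c z φ) →
        Eqv (z (Sum.inl 0)) (z (Sum.inr 0)) ∧ (Prd (z (Sum.inr 0)) ↔ t)) :
    EntailsRight p r q := by
  intro ψ hψ
  rw [globalEntails_iff]
  intro N _ _ c hc z hz
  rw [sat_of_mem_unionLeft] at hz
  have := hc.models_genTheory
  have h1 := h N _ z hz.2
  have h2 := (hp N c hc _).1 hz.1
  have h3 : Eqv ((z ∘ Sum.inl) 0) ((z ∘ Sum.inr) 0) := h1.1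
  rw [sat_relabel]
  exact (hq N c hc _).2 (h2.of_eqv (satisfiesAxioms_of_model N) h3 h1.2) ψ hψ

theorem entailsRight_of_rho (hp : IsNewType True p) (hq : IsNewType False q)
    {r : TypeOver LOD (∅ : Set U) (Fin 1 ⊕ Fin 1)} (hr : rho U ∈ formulas r) :
    EntailsRight p r q :=
  entailsRight_of_eqv hp hq fun _ _ _ _ hz =>
    have h := sat_rho.1 (hz _ hr)
    ⟨h.1, iff_false_intro h.2.2⟩

/-- For `q` dominating `p` the variables trade places, so `rho` is replaced by `χ`, which records
whether the second variable lies in `P`. -/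
theorem dominates_of_isNewType {s t : Prop} (hp : IsNewType s p) (hq : IsNewType t q)
    {κ : Cardinal.{u}} (hκ : ℵ₀ ≤ κ) : Dominates κ p q := by
  obtain ⟨N, _, c, z, r, hr, hrz, he, -, ht⟩ := exists_isJoint_eqv hp hq
  let χ : LOD.Formula (Fin 1 ⊕ Fin 1) :=
    eqvF (Term.var (Sum.inl 0)) (Term.var (Sum.inr 0)) ⊓ literal t (prdF (Term.var (Sum.inr 0)))
  have hχ : ∀ {M : Type u} [LOD.Structure M] {z : Fin 1 ⊕ Fin 1 → M}, χ.Realize z ↔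
      Eqv (z (Sum.inl 0)) (z (Sum.inr 0)) ∧ (Prd (z (Sum.inr 0)) ↔ t) := by
    intro M _ z
    rw [Formula.realize_inf, realize_literal]
    exact and_congr realize_eqv (iff_congr realize_prd Iff.rfl)
  refine ⟨∅, ?_, r, hr, entailsRight_of_eqv hp hq fun M _ c' z' hz' => ?_⟩
  · rw [Cardinal.mk_eq_zero]
    exact Cardinal.aleph0_pos.trans_le hκ
  · refine hχ.1 ((sat_onFormula c' z' χ).1 (hz' _ ?_))
    rw [hrz]
    exact (sat_onFormula c z χ).2 (hχ.2 ⟨he, ht⟩)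

theorem entailsLeft_of_rho (hp : IsNewType True p) (hq : IsNewType False q)
    {r : TypeOver LOD (∅ : Set U) (Fin 1 ⊕ Fin 1)} (hr : rho U ∈ formulas r) :
    EntailsLeft q r p := by
  intro ψ hψ
  rw [globalEntails_iff]
  intro N _ _ c hc z hz
  rw [sat_of_mem_unionRight] at hz
  have := hc.models_genTheory
  have hN := satisfiesAxioms_of_model N
  have h1 := sat_rho.1 (hz.2 _ hr)
  have h2 := (hq N c hc _).1 hz.1
  have h3 : Eqv ((z ∘ Sum.inr) 0) ((z ∘ Sum.inl) 0) := hN.eqv_symm _ _ h1.1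
  rw [sat_relabel]
  exact (hp N c hc _).2 (h2.of_eqv hN h3 (iff_true_intro h1.2.1)) ψ hψ

end Types

/-! ### Consequences of saturation -/

section Saturation

theorem AtomEq.of_sat {A α N₁ N₂ : Type*} [LOD.Structure N₁] [LOD.Structure N₂] {c₁ : A → N₁}
    {c₂ : A → N₂} {x₁ : α → N₁} {x₂ : α → N₂}
    (h : ∀ φ : LOD[[A]].Formula α, Sat c₁ x₁ φ → Sat c₂ x₂ φ) :
    AtomEq (Sum.elim c₁ x₁) (Sum.elim c₂ x₂) := by
  refine AtomEq.of_realize fun ψ => ?_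
  obtain ⟨φ, rfl⟩ := (BoundedFormula.constantsVarsEquiv (L := LOD) (γ := A)
    (α := α) (n := 0)).surjective ψ
  rw [← sat_iff_constantsVarsEquiv, ← sat_iff_constantsVarsEquiv]
  refine ⟨h φ, fun h2 => ?_⟩
  by_contra h1
  exact h (∼φ) h1 h2

theorem IsNew.of_atomEq {A N₁ N₂ : Type*} [LOD.Structure N₁] [LOD.Structure N₂] {c₁ : A → N₁}
    {c₂ : A → N₂} {x₁ : Fin 1 → N₁} {x₂ : Fin 1 → N₂}
    (h : AtomEq (Sum.elim c₁ x₁) (Sum.elim c₂ x₂)) {s : Prop} (hx : IsNew s c₁ (x₁ 0)) :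
    IsNew s c₂ (x₂ 0) :=
  ⟨(h.obj (Sum.inr 0)).1 hx.obj, (h.prd (Sum.inr 0)).symm.trans hx.prd,
    fun a ha => hx.not_eqv a ((h.eqv (Sum.inr 0) (Sum.inl a)).2 ha)⟩

variable {κ : Cardinal.{u}} {U : Type u} [LOD.Structure U]

/-- The type over `A` of a point of an elementary extension is a complete type of `U`, so saturation
realises it. This is used to escape small sets. -/
theorem IsSaturated.exists_atomEq (hsat : IsSaturated LOD κ U) {A : Set U} (hA : #A < κ)
    {N : Type u} [LOD.Structure N] [Nonempty N] {c : U → N} (hc : Elem LOD (id : U → U) c)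
    (x : Fin 1 → N) :
    ∃ u : Fin 1 → U, AtomEq (Sum.elim (c ∘ ((↑) : A → U)) x) (Sum.elim ((↑) : A → U) u) := by
  obtain ⟨r, hr⟩ : ∃ r : TypeOver LOD A (Fin 1), formulas r = {φ | Sat (c ∘ (↑)) x φ} :=
    exists_completeType (hc.comp _) x
  obtain ⟨u, hu⟩ := hsat A hA r
  refine ⟨u, AtomEq.of_sat fun φ hφ => ?_⟩
  rw [hr] at hu
  exact (realize_iff_sat u φ).1 (hu φ hφ)

variable [U ⊨ genTheory]

theorem IsSaturated.exists_obj (hsat : IsSaturated LOD κ U) {A : Set U} (hA : #A < κ) :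
    ∃ u : U, Obj u ∧ ∀ v ∈ A, ¬ Eqv u v := by
  obtain ⟨N, _, _, _, c, x, hc, hx⟩ := exists_isNew U True
  obtain ⟨u, hu⟩ := hsat.exists_atomEq hA hc x
  have := (hx.comp ((↑) : A → U)).of_atomEq hu
  exact ⟨u 0, this.obj, fun v hv => this.not_eqv ⟨v, hv⟩⟩

theorem IsSaturated.exists_dig (hsat : IsSaturated LOD κ U) {A : Set U} (hA : #A < κ) :
    ∃ d : U, Dig d ∧ d ∉ A := by
  obtain ⟨_, hS, hsome, hd, -⟩ :=
    (satisfiesAxioms_of_model U).exists_new_dig (fun _ _ => False) (by simp)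
  obtain ⟨N, _, _, _, f, hf, hc⟩ := exists_elem_extending hS hsome
  obtain ⟨u, hu⟩ := hsat.exists_atomEq hA hc fun _ => f none
  refine ⟨u 0, (hu.dig (Sum.inr 0)).1 ((hf.dig none).2 hd), fun h => ?_⟩
  have h1 := (hu.eq (Sum.inr 0) (Sum.inl ⟨u 0, h⟩)).2 rfl
  simpa using (hf.eq none (some (u 0))).1 h1

end Saturation

/-! ### Undecided instances of `R` on a common new class -/

section Undecided

variable {U : Type u} [LOD.Structure U] [U ⊨ genTheory] {p q : GlobalType LOD U (Fin 1)}

/-- Over `A`, a pair in a common new class has an atomic type that can be continued to all of the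
model with `R(x, y, d)` prescribed for a given `d` outside `A`. -/
theorem exists_pair_extending {A : Set U} {N₁ : Type u} [LOD.Structure N₁]
    (h₁ : SatisfiesAxioms N₁) {c₁ : A → N₁} (hc₁ : AtomEq c₁ ((↑) : A → U))
    {z₁ : Fin 1 ⊕ Fin 1 → N₁} (hx₁ : IsNew True c₁ (z₁ (Sum.inl 0)))
    (hy₁ : IsNew False c₁ (z₁ (Sum.inr 0))) (he₁ : Eqv (z₁ (Sum.inl 0)) (z₁ (Sum.inr 0)))
    {d : U} (hd : Dig d) (hdA : d ∉ A) (v : Prop) :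
    ∃ (N : Type u) (_ : LOD.Structure N) (_ : Nonempty N) (_ : N ⊨ genTheory) (c : U → N)
      (z : Fin 1 ⊕ Fin 1 → N), Elem LOD (id : U → U) c ∧ IsNew True c (z (Sum.inl 0)) ∧
        IsNew False c (z (Sum.inr 0)) ∧
        AtomEq (Sum.elim (c ∘ ((↑) : A → U)) z) (Sum.elim c₁ z₁) ∧
        (Arr (z (Sum.inl 0)) (z (Sum.inr 0)) (c d) ↔ v) := by
  set x₁ := z₁ (Sum.inl 0) with hx₁'
  set y₁ := z₁ (Sum.inr 0) with hy₁'
  -- First `x`, alone in its class; it becomes `some none` in `Option (Option U)`, where `y` will be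
  -- `none`.
  obtain ⟨_, hS, hsome, ho, hp, he, -⟩ :=
    (satisfiesAxioms_of_model U).exists_new_obj (fun _ => False) (by simp) True
      (fun _ _ => False) (fun _ _ => False) (by simp) (by simp) (by simp)
  have hdig : ∀ e : A, Dig (c₁ e) → Dig (some (e : U)) := fun e h =>
    (hsome.dig _).2 ((hc₁.dig e).1 h)
  have hnone : Eqv (none : Option U) none := hS.eqv_refl _ ho
  -- Then `y`, in the class of `x`. Its relations with `x` are copied from `z₁` at points of `A`,
  -- given by `v` at `d`, and empty elsewhere; `d ∉ A` prevents a clash.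
  obtain ⟨_, hS', hsome', ho', hp', he', hout, hinn⟩ :=
    hS.exists_new_obj (fun y => Eqv none y)
      (fun x y h => ⟨hS.eqv_trans _ _ _ (hS.eqv_symm _ _ h), hS.eqv_trans _ _ _ h⟩) False
      (fun y d' => y = none ∧ ∃ e : A, d' = some (e : U) ∧ Arr y₁ x₁ (c₁ e))
      (fun y d' => y = none ∧
        ((∃ e : A, d' = some (e : U) ∧ Arr x₁ y₁ (c₁ e)) ∨ (d' = some d ∧ v)))
      (by
        rintro y d' ⟨rfl, e, rfl, h⟩
        exact ⟨hnone, hdig e (h₁.arr_sort _ _ _ h).2.2⟩)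
      (by
        rintro y d' ⟨rfl, ⟨e, rfl, h⟩ | ⟨rfl, -⟩⟩
        · exact ⟨hnone, hdig e (h₁.arr_sort _ _ _ h).2.2⟩
        · exact ⟨hnone, (hsome.dig d).2 hd⟩)
      (by
        rintro y d' ⟨⟨-, e, rfl, h⟩, -, ⟨e', h', h''⟩ | ⟨h', -⟩⟩
        · obtain rfl : e = e' := Subtype.ext (Option.some_inj.1 h')
          exact h₁.arr_asymm _ _ _ h h''
        · exact hdA (Option.some_inj.1 h' ▸ e.2))
  obtain ⟨N, _, _, _, f, hf, hc⟩ := exists_elem_extending hS' ((hsome'.comp some).trans hsome)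
  have hN := satisfiesAxioms_of_model N
  have hx : IsNew True (f ∘ (some ∘ some : U → Option (Option U))) (f (some none)) :=
    ⟨(hf.obj _).2 ((hsome'.obj _).2 ho), (hf.prd _).trans ((hsome'.prd _).trans hp),
      fun a ha => (he a).1 ((hsome'.eqv none (some a)).1
        ((hf.eqv (some none) (some (some a))).1 ha))⟩
  have hy : IsNew False (f ∘ (some ∘ some : U → Option (Option U))) (f none) :=
    hx.of_eqv hN (hN.eqv_symm _ _ ((hf.eqv none (some none)).2 ((he' none).2 hnone)))
      ((hf.prd _).trans hp')
  have hxy : AtomEq (Sum.elim (some ∘ ((↑) : A → U)) fun _ : Fin 1 => none)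
      (Sum.elim c₁ fun _ : Fin 1 => x₁) :=
    AtomEq.elim_new hS h₁ ((hsome.comp ((↑) : A → U)).trans hc₁.symm)
      ⟨ho, hp, fun a => (he a).1⟩ hx₁
  have hxyz : AtomEq
      (Sum.elim (some ∘ Sum.elim (some ∘ ((↑) : A → U)) fun _ : Fin 1 => none)
        fun _ : Fin 1 => none)
      (Sum.elim (Sum.elim c₁ fun _ : Fin 1 => x₁) fun _ : Fin 1 => y₁) := by
    refine AtomEq.elim_obj hS' h₁
      ((hsome'.comp (Sum.elim (some ∘ ((↑) : A → U)) fun _ : Fin 1 => none)).trans hxy)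
      ho' hy₁.obj (hp'.trans hy₁.prd.symm) (fun i h => by cases h) ?_ ?_ ?_ ?_
    · rintro (i | i)
      · exact hy₁.ne h₁ i
      · intro h
        exact hy₁.prd.1 (h ▸ hx₁.prd.2 trivial : Prd y₁)
    · rintro (i | i)
      · exact iff_of_false (fun h => (he i).1 ((he' _).1 h)) (hy₁.not_eqv i)
      · exact iff_of_true ((he' _).2 hnone) (h₁.eqv_symm _ _ he₁)
    · rintro (i | i) k
      · refine iff_of_false (fun h => (he i).1 ((he' _).1 (hS'.arr_eqv _ _ _ h))) fun h =>
          hy₁.not_eqv i (h₁.arr_eqv _ _ _ h)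
      · refine (hout _ _).trans ?_
        rcases k with k | k
        · constructor
          · rintro ⟨-, e, h, h'⟩
            obtain rfl : k = e := Subtype.ext (Option.some_inj.1 h)
            exact h'
          · exact fun h => ⟨rfl, k, rfl, h⟩
        · refine iff_of_false ?_ fun h => h₁.not_dig_of_obj hx₁.obj (h₁.arr_sort _ _ _ h).2.2
          rintro ⟨-, e, h, -⟩
          cases h
    · rintro (i | i) k
      · refine iff_of_false (fun h => (he i).1 ((he' _).1
          (hS'.eqv_symm _ _ (hS'.arr_eqv _ _ _ h)))) fun h =>
          hy₁.not_eqv i (h₁.eqv_symm _ _ (h₁.arr_eqv _ _ _ h))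
      · refine (hinn _ _).trans ?_
        rcases k with k | k
        · constructor
          · rintro ⟨-, ⟨e, h, h'⟩ | ⟨h, -⟩⟩
            · obtain rfl : k = e := Subtype.ext (Option.some_inj.1 h)
              exact h'
            · exact absurd (Option.some_inj.1 h ▸ k.2) hdA
          · exact fun h => ⟨rfl, Or.inl ⟨k, rfl, h⟩⟩
        · refine iff_of_false ?_ fun h => h₁.not_dig_of_obj hx₁.obj (h₁.arr_sort _ _ _ h).2.2
          rintro ⟨-, ⟨e, h, -⟩ | ⟨h, -⟩⟩ <;> cases h
  refine ⟨N, _, ‹_›, ‹_›, _, Sum.elim (fun _ => f (some none)) fun _ => f none, hc, hx, hy, ?_, ?_⟩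
  · have h1 := ((hf.comp _).trans hxyz).comp (Equiv.sumAssoc A (Fin 1) (Fin 1)).symm
    convert h1 using 1
    · funext i
      rcases i with i | i | i <;> rfl
    · funext i
      rcases i with i | i | i
      · rfl
      · simp [hx₁', Subsingleton.elim i 0]
      · simp [hy₁', Subsingleton.elim i 0]
  · refine (hf.arr (some none) none (some (some d))).trans ((hinn none (some d)).trans ?_)
    constructor
    · rintro ⟨-, ⟨e, h, -⟩ | ⟨-, h⟩⟩
      · exact absurd (Option.some_inj.1 h ▸ e.2) hdA
      · exact h
    · exact fun h => ⟨rfl, Or.inr ⟨rfl, h⟩⟩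

/-- Over `A`, `x₁` has the atomic type of a true realisation of `p`, whose newness is known. -/
theorem isNew_of_forall_sat {s : Prop} (hp : IsNewType s p) {A : Set U} {N₁ : Type u}
    [LOD.Structure N₁] {c₁ : A → N₁} {x₁ : Fin 1 → N₁}
    (h : ∀ φ : LOD[[A]].Formula (Fin 1), inclTop φ ∈ formulas p → Sat c₁ x₁ φ) :
    IsNew s c₁ (x₁ 0) := by
  obtain ⟨N, _, _, _, c, x, hc, hx⟩ := exists_isNew U s
  refine (hx.comp ((↑) : A → U)).of_atomEq (AtomEq.of_sat fun φ hφ => h φ ?_)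
  rw [hp.mem_iff hc hx, sat_onFormula_map]
  exact hφ

/-- Either truth value of `R(x, y, d)` occurs in a common realisation of `p`, `q` and `r`. -/
theorem not_decidesArr (hp : IsNewType True p) (hq : IsNewType False q) {A : Set U}
    {r : TypeOver LOD A (Fin 1 ⊕ Fin 1)} (hr : IsJoint p q r) (he : eqvFormula A ∈ formulas r)
    {d : U} (hd : Dig d) (hdA : d ∉ A) :
    ¬ DecidesArr (unionLeft p r) d ∧ ¬ DecidesArr (unionRight q r) d := by
  obtain ⟨N₁, _, _, c₁, z₁, hc₁, hr₁⟩ := exists_formulas_eq_sat r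
  have hc₁' : Elem LOD ((↑) : A → U) c₁ := hc₁
  have := hc₁'.models_genTheory
  have hx₁ : IsNew True c₁ (z₁ (Sum.inl 0)) :=
    isNew_of_forall_sat (x₁ := z₁ ∘ Sum.inl) hp fun φ hφ => by
      have := hr.left φ hφ
      rwa [hr₁, Set.mem_ofPred_eq, sat_relabel] at this
  have hy₁ : IsNew False c₁ (z₁ (Sum.inr 0)) :=
    isNew_of_forall_sat (x₁ := z₁ ∘ Sum.inr) hq fun φ hφ => by
      have := hr.right φ hφ
      rwa [hr₁, Set.mem_ofPred_eq, sat_relabel] at this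
  rw [hr₁] at he
  have key : ∀ v : Prop, ∃ (N : Type u) (_ : LOD.Structure N) (_ : Nonempty N) (c : U → N)
      (z : Fin 1 ⊕ Fin 1 → N), Elem LOD (id : U → U) c ∧
        (∀ ψ ∈ unionLeft p r, Sat c z ψ) ∧ (∀ ψ ∈ unionRight q r, Sat c z ψ) ∧
          (Sat c z (arrFormula d) ↔ v) := by
    intro v
    obtain ⟨N, _, _, _, c, z, hc, hx, hy, hz, ha⟩ :=
      exists_pair_extending (satisfiesAxioms_of_model N₁) hc₁'.atomEq hx₁ hy₁
        (sat_eqvFormula.1 he) hd hdA v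
    have hr' : ∀ φ ∈ formulas r, Sat (c ∘ ((↑) : A → U)) z φ := fun φ hφ => by
      rw [hr₁] at hφ
      exact (hz.sat_iff φ).2 hφ
    exact ⟨N, _, ‹_›, c, z, hc, sat_of_mem_unionLeft.2 ⟨(hp N c hc _).2 hx, hr'⟩,
      sat_of_mem_unionRight.2 ⟨(hq N c hc _).2 hy, hr'⟩, sat_arrFormula.trans ha⟩
  obtain ⟨N, _, _, c, z, hc, hl, hr, ha⟩ := key True
  obtain ⟨N', _, _, c', z', hc', hl', hr', ha'⟩ := key False
  constructor
  · rintro (h | h)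
    · exact ha'.1 (globalEntails_iff.1 h N' c' hc' z' hl')
    · exact globalEntails_iff.1 h N c hc z hl (ha.2 trivial)
  · rintro (h | h)
    · exact ha'.1 (globalEntails_iff.1 h N' c' hc' z' hr')
    · exact globalEntails_iff.1 h N c hc z hr (ha.2 trivial)

end Undecided

/-! ### Failure of isolation -/

section Isolation

/-- The formula `R(x, y, d)` with constants `y` and `d`. -/
def arrConst {B : Type*} (y d : B) : LOD[[B]].Formula (Fin 1) :=
  Relations.formula ((LOD.lhomWithConstants B).onRelation Rel.arr)
    ![Term.var 0, (LOD.con y).term, (LOD.con d).term]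

theorem sat_arrConst {B N : Type*} [LOD.Structure N] {c : B → N} {x : Fin 1 → N} {y d : B} :
    Sat c x (arrConst y d) ↔ Arr (x 0) (c y) (c d) := by
  let : (constantsOn B).Structure N := constantsOn.structure c
  rw [Sat, arrConst, Formula.realize_rel, Arr, iff_iff_eq]
  change Structure.RelMap (L := LOD) Rel.arr _ = _
  congr 1
  funext i
  fin_cases i
  · rfl
  · exact realize_con_term c x y
  · exact realize_con_term c x d

variable {κ : Cardinal.{u}} {U : Type u} [LOD.Structure U] [U ⊨ genTheory]

/-- In an elementary extension, the type of a point of a new class over the model and a further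
point of a new class is not determined by few parameters. -/
theorem not_isFsIsolated_tp (hsat : IsSaturated LOD κ U) {N : Type u} [LOD.Structure N]
    [Nonempty N] (j : U ↪ₑ[LOD] N) {s t : Prop} {a b : Fin 1 → N} (ha : IsNew s j (a 0))
    (hb : IsNew t j (b 0)) (hab : a 0 ≠ b 0) :
    ¬ IsFsIsolated κ (tp (L := LOD) a (Set.range j ∪ Set.range b)) := by
  rintro ⟨A, hAB, hA, hiso⟩
  have hj : Elem LOD (id : U → U) j := fun ψ => (j.map_formula ψ id).symm
  have := hj.models_genTheory
  have hN := satisfiesAxioms_of_model N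
  have hA' : #(j ⁻¹' A) < κ := (Cardinal.mk_preimage_of_injective _ _ j.injective).trans_lt hA
  have hmem : ∀ y : A, (∃ u ∈ j ⁻¹' A, (y : N) = j u) ∨ (y : N) = b 0 := by
    rintro ⟨y, hy⟩
    rcases hAB hy with ⟨u, rfl⟩ | ⟨i, rfl⟩
    · exact Or.inl ⟨u, hy, rfl⟩
    · exact Or.inr (congrArg b (Subsingleton.elim i 0))
  let B : Set N := Set.range j ∪ Set.range b
  have hjB : ∀ u, j u ∈ B := fun u => Or.inl ⟨u, rfl⟩
  have hbB : b 0 ∈ B := Or.inr ⟨0, rfl⟩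
  -- a realisation of the restricted type realises the whole type
  have key : ∀ (N' : Type u) [LOD.Structure N'] [Nonempty N'] [N' ⊨ genTheory] (f : N → N')
      (x : Fin 1 → N'), AtomEq f (id : N → N) →
      AtomEq (Sum.elim (f ∘ ((↑) : A → N)) x) (Sum.elim ((↑) : A → N) a) →
      ∀ φ : LOD[[B]].Formula (Fin 1), Sat ((↑) : B → N) a φ →
        Sat (f ∘ ((↑) : B → N)) x φ := by
    intro N' _ _ _ f x hf hx φ hφ
    have h1 := hiso φ (by rw [formulas_tp]; exact hφ)
    refine entails_iff.1 h1 N' (f ∘ ((↑) : B → N)) (hf.comp _).elem x ?_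
    rintro _ ⟨hψ, χ, rfl⟩
    rw [formulas_tp, Set.mem_ofPred_eq, sat_onFormula_map] at hψ
    rw [sat_onFormula_map]
    exact (hx.sat_iff χ).2 hψ
  by_cases he : Eqv (a 0) (b 0)
  -- Equivalent case: a twin `x` of `a` is adjoined to the class of `b`, related to `b` as `a` is,
  -- except that the truth value of `R(x, b, d)` is flipped at one `d` with `j d ∉ A`; there `R(b,
  -- x, d)` is dropped to keep asymmetry.
  · obtain ⟨d, hd, hdA⟩ := hsat.exists_dig hA'
    have hjd : Dig (j d) := (hj.atomEq.dig d).2 hd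
    obtain ⟨_, hS, hsome, ho, hp, he', hout, hinn⟩ :=
      hN.exists_new_obj (fun y => Eqv (b 0) y)
        (fun x y h => ⟨hN.eqv_trans _ _ _ (hN.eqv_symm _ _ h), hN.eqv_trans _ _ _ h⟩) s
        (fun y e => y = b 0 ∧ (e = j d ∧ ¬ Arr (a 0) (b 0) (j d) ∨ e ≠ j d ∧ Arr (a 0) (b 0) e))
        (fun y e => y = b 0 ∧ e ≠ j d ∧ Arr (b 0) (a 0) e)
        (by
          rintro y e ⟨rfl, ⟨rfl, -⟩ | ⟨-, h⟩⟩
          · exact ⟨hN.eqv_refl _ hb.obj, hjd⟩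
          · exact ⟨hN.eqv_refl _ hb.obj, (hN.arr_sort _ _ _ h).2.2⟩)
        (by
          rintro y e ⟨rfl, -, h⟩
          exact ⟨hN.eqv_refl _ hb.obj, (hN.arr_sort _ _ _ h).2.2⟩)
        (by
          rintro y e ⟨⟨-, ⟨rfl, -⟩ | ⟨-, h⟩⟩, -, h', h''⟩
          · exact h' rfl
          · exact hN.arr_asymm _ _ _ h h'')
    have hne : ∀ y : A, (y : N) ≠ j d := fun y hy => hdA (show j d ∈ A from hy ▸ y.2)
    have hane : ∀ y : A, a 0 ≠ y := by
      intro y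
      rcases hmem y with ⟨u, -, hu⟩ | hu
      · rw [hu]
        exact ha.ne hN u
      · rwa [hu]
    -- Within `A` only `b` can lie in the class of `a`, so the relations with `b` fix the atomic
    -- type over `A`.
    have hfar : ∀ y : A, (y : N) ≠ b 0 → ¬ Eqv (a 0) y := by
      intro y hy
      rcases hmem y with ⟨u, -, hu⟩ | hu
      · rw [hu]
        exact ha.not_eqv u
      · exact absurd hu hy
    have hx : AtomEq (Sum.elim (some ∘ ((↑) : A → N)) fun _ : Fin 1 => none)
        (Sum.elim ((↑) : A → N) a) := by
      refine AtomEq.elim_obj hS hN (hsome.comp ((↑) : A → N)) ho ha.obj (hp.trans ha.prd.symm)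
        (fun y h => by cases h) hane (fun y => ?_) (fun y e => ?_) fun y e => ?_
      · exact (he' y).trans ⟨hN.eqv_trans _ _ _ he, hN.eqv_trans _ _ _ (hN.eqv_symm _ _ he)⟩
      · refine (hout y e).trans ⟨?_, fun h => ?_⟩
        · rintro ⟨hy, ⟨h, -⟩ | ⟨-, h⟩⟩
          · exact absurd h (hne e)
          · change Arr (a 0) (y : N) (e : N); rw [hy]; exact h
        · have hy : (y : N) = b 0 := by
            by_contra hy
            exact hfar y hy (hN.arr_eqv _ _ _ h)
          exact ⟨hy, Or.inr ⟨hne e, hy ▸ h⟩⟩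
      · refine (hinn y e).trans ⟨?_, fun h => ?_⟩
        · rintro ⟨hy, -, h⟩
          change Arr (y : N) (a 0) (e : N); rw [hy]; exact h
        · have hy : (y : N) = b 0 := by
            by_contra hy
            exact hfar y hy (hN.eqv_symm _ _ (hN.arr_eqv _ _ _ h))
          exact ⟨hy, hne e, hy ▸ h⟩
    obtain ⟨N', _, _, _, f, hf⟩ := exists_model_extending hS
    have hx' : AtomEq (Sum.elim ((f ∘ some) ∘ ((↑) : A → N)) fun _ : Fin 1 => f none)
        (Sum.elim ((↑) : A → N) a) := by
      convert (hf.comp (Sum.elim (some ∘ ((↑) : A → N)) fun _ : Fin 1 => none)).trans hx using 1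
      funext i
      rcases i with i | i <;> rfl
    have h1 := key N' (f ∘ some) (fun _ => f none) ((hf.comp some).trans hsome) hx'
    have harr : Sat ((f ∘ some) ∘ ((↑) : B → N)) (fun _ : Fin 1 => f none)
        (arrConst (⟨b 0, hbB⟩ : B) ⟨j d, hjB d⟩) ↔ ¬ Arr (a 0) (b 0) (j d) := by
      refine sat_arrConst.trans ((hf.arr none (some (b 0)) (some (j d))).trans
        ((hout _ _).trans ?_))
      simp
    by_cases h2 : Arr (a 0) (b 0) (j d)
    · exact harr.1 (h1 (arrConst ⟨b 0, hbB⟩ ⟨j d, hjB d⟩) (sat_arrConst.2 h2)) h2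
    · exact h1 (∼(arrConst ⟨b 0, hbB⟩ ⟨j d, hjB d⟩))
        ((sat_not _ _ _).2 fun h => h2 (sat_arrConst.1 h)) (harr.2 h2)
  -- Inequivalent case: `a` and a point `x` in the class of a `u` inequivalent to `A` are both new
  -- over `A`, hence have the same type there, but only `x` is equivalent to `j u`.
  · obtain ⟨u, hu, huA⟩ := hsat.exists_obj hA'
    have hju : Obj (j u) := (hj.atomEq.obj u).2 hu
    obtain ⟨x, hux, -, hxs, -⟩ := (isGeneric_of_model N).extend_obj (j u) hju ∅ ∅ (by simp)
      (by simp) s (fun _ _ => False) (fun _ _ => False) (by simp)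
    have hxnew : IsNew s ((↑) : A → N) x := by
      refine ⟨(hN.eqv_sort _ _ hux).2, hxs, fun y hy => ?_⟩
      have huy := hN.eqv_trans _ _ _ hux hy
      rcases hmem y with ⟨v, hv, hyv⟩ | hyb
      · rw [hyv] at huy
        exact huA v hv ((hj.atomEq.eqv u v).1 huy)
      · rw [hyb] at huy
        exact hb.not_eqv u (hN.eqv_symm _ _ huy)
    have hanew : IsNew s ((↑) : A → N) (a 0) := by
      refine ⟨ha.obj, ha.prd, fun y hy => ?_⟩
      rcases hmem y with ⟨v, hv, hyv⟩ | hyb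
      · exact ha.not_eqv v (hyv ▸ hy)
      · exact he (hyb ▸ hy)
    have h1 := key N id (fun _ => x) (AtomEq.refl _)
      (AtomEq.elim_new hN hN (AtomEq.refl _) hxnew hanew) (notEqvFormula (⟨j u, hjB u⟩ : B))
      (sat_notEqvFormula.2 (ha.not_eqv u))
    exact sat_notEqvFormula.1 h1 (hN.eqv_symm _ _ hux)

end Isolation

end FirstOrder.Domination

/-! ### The theorem -/

theorem mainTheorem6 :
    IsFraisse finiteClass ∧
    (∃ (M : Type) (_ : LOD.Structure M) (_ : Countable M),
      IsFraisseLimit finiteClass M) ∧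
    ∀ (M : Type) [LOD.Structure M] [Countable M],
      IsFraisseLimit finiteClass M →
      (∀ (N : Type u) [LOD.Structure N],
        N ⊨ LOD.completeTheory M → IsGeneric N) ∧
      ∀ (κ : Cardinal.{u}), ℵ₀ ≤ κ →
      ∀ (U : Type u) [LOD.Structure U] [Nonempty U],
        U ⊨ LOD.completeTheory M →
        IsSaturated LOD κ U →
        IsStronglyHomogeneous LOD κ U →
        ∃ p q : GlobalType LOD U (Fin 1),
          (∀ p' : GlobalType LOD U (Fin 1),
            newClassPrd U ⊆ formulas p' ↔ p' = p) ∧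
          (∀ q' : GlobalType LOD U (Fin 1),
            newClassNotPrd U ⊆ formulas q' ↔ q' = q) ∧
          IsInvariantOver ∅ p ∧ IsInvariantOver ∅ q ∧
          (∃ r : TypeOver LOD (∅ : Set U) (Fin 1 ⊕ Fin 1),
            IsJoint p q r ∧ rho U ∈ formulas r) ∧
          (∀ r : TypeOver LOD (∅ : Set U) (Fin 1 ⊕ Fin 1),
            IsJoint p q r → rho U ∈ formulas r →
              EntailsRight p r q ∧ EntailsLeft q r p) ∧
          Dominates κ p q ∧ Dominates κ q p ∧
          (∀ (A : Set U), #A < κ → ∀ r : TypeOver LOD A (Fin 1 ⊕ Fin 1),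
            IsJoint p q r → eqvFormula A ∈ formulas r →
              (∃ d : U, Dig d ∧ ¬ DecidesArr (unionLeft p r) d) ∧
              (∃ d : U, Dig d ∧ ¬ DecidesArr (unionRight q r) d)) ∧
          ∀ (N : Type u) [LOD.Structure N] [Nonempty N]
            (j : U ↪ₑ[LOD] N) (a b : Fin 1 → N),
            Realises j a p → Realises j b q →
              ¬ IsFsIsolated κ
                  (tp (L := LOD) a (Set.range j ∪ Set.range b)) ∧
              ¬ IsFsIsolated κ
                  (tp (L := LOD) b (Set.range j ∪ Set.range a)) := by
  refine ⟨isFraisseLimit_gen.isFraisse, ⟨Gen, inferInstance, inferInstance, isFraisseLimit_gen⟩,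
    fun M _ _ hM => ?_⟩
  rw [completeTheory_eq_gen hM]
  refine ⟨fun N _ _ => isGeneric_of_model N, fun κ hκ U _ _ _ hsat _ => ?_⟩
  obtain ⟨p, hp, hp'⟩ := exists_isNewType (U := U) (Γ := newClassPrd U)
    fun N _ c hN hc x => sat_newClassPrd hN hc
  obtain ⟨q, hq, hq'⟩ := exists_isNewType (U := U) (Γ := newClassNotPrd U)
    fun N _ c hN hc x => sat_newClassNotPrd hN hc
  refine ⟨p, q, hp, hq, hp'.isInvariantOver, hq'.isInvariantOver, exists_isJoint_rho hp' hq',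
    fun r _ hrho => ⟨entailsRight_of_rho hp' hq' hrho, entailsLeft_of_rho hp' hq' hrho⟩,
    dominates_of_isNewType hp' hq' hκ, dominates_of_isNewType hq' hp' hκ,
    fun A hA r hr he => ?_, fun N _ _ j a b ha hb => ?_⟩
  · obtain ⟨d, hd, hdA⟩ := hsat.exists_dig hA
    have := not_decidesArr hp' hq' hr he hd hdA
    exact ⟨⟨d, hd, this.1⟩, ⟨d, hd, this.2⟩⟩
  · have hj : Elem LOD (id : U → U) j := fun ψ => (j.map_formula ψ id).symm
    have ha' := (hp' N j hj a).1 ha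
    have hb' := (hq' N j hj b).1 hb
    have hab : a 0 ≠ b 0 := fun h => hb'.prd.1 (h ▸ ha'.prd.2 trivial)
    exact ⟨not_isFsIsolated_tp hsat j ha' hb' hab, not_isFsIsolated_tp hsat j hb' ha' hab.symm⟩
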